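/- Let $M$ be a smooth manifold and let $(\mathcal A,\rho,[\cdot,\cdot])$ be a Lie algebroid over $M$: a smooth real vector bundle of finite rank with a Lie bracket on $\Gamma(\mathcal A)$ and a smooth bundle map $\rho:\mathcal A\to TM$ (the anchor) such that $\rho([S_1,S_2])=[\rho(S_1),\rho(S_2)]$ and $[S_1,fS_2]=f[S_1,S_2]+(\rho(S_1)\cdot f)S_2$ for all sections $S_1,S_2$ and all $f\in C^\infty(M)$. A *compatible triple* $(\omega,J,g)$ on $\mathcal A$ consists of a smooth nondegenerate 2-form $\omega$ on $\mathcal A$ that is closed for the Lie algebroid differential $d^{\mathcal A}$, a smooth bundle endomorphism $J$ of $\mathcal A$ with $J^2=-\mathrm{id}$, and a smooth Riemannian metric $g$ on $\mathcal A$, such that $g(JS,JT)=g(S,T)$ and $\omega(S,T)=g(S,JT)$. A compatible triple on a manifold $O$ is a compatible triple on the Lie algebroid $TO$ (identity anchor, Lie bracket of vector fields). Let $(\omega,J,g)$ be a compatible triple on $\mathcal A$. For $p\in M$ let $L_p=\ker\rho_p$, let $W^\omega$ denote the $\omega$-orthogonal complement of a subspace $W\subseteq\mathcal A_p$, and put $$L^1_p=L_p\cap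 L_p^\omega,\qquad L^2_p=\{v\in L_p : g(v,w)=0\ \text{for all } w\in L^1_p\},\qquad E^1_p=J(L^1_p),\qquad E^2_p=(L_p+E^1_p)^\omega .$$ Let $\Lambda_p=\rho(E^2_p+L^1_p)\subseteq T_pM$. **Theorem.** Suppose that $J(L^2_p)\subseteq L^2_p$ for every $p\in M$. Then $J(E^2_p)\subseteq E^2_p$ for every $p\in M$. Moreover, let $\mathcal O$ be an integral submanifold of $\Lambda$, that is, an (injectively) immersed submanifold of $M$ with $T_p\mathcal O=\Lambda_p$ for every $p\in\mathcal O$. Then there is exactly one compatible triple $(\omega_{\mathcal O},J_{\mathcal O},g_{\mathcal O})$ on $\mathcal O$ such that, for all $p\in\mathcal O$ and $X,Y\in T_p\mathcal O$, $$\omega_{\mathcal O}(X,Y)=\omega(a,b)\quad\text{for all } a,b\in E^2_p+L^1_p \text{ with } \rho(a)=X,\ \rho(b)=Y,$$ $$J_{\mathcal O}(X)=\rho(J(a)),\quad g_{\mathcal O}(X,Y)=g(a,b)\quad\text{for all } a,b\in E^2_p \text{ with } \rho(a)=X,\ \rho(b)=Y.$$ In other words, the forms $\omega_{\mathcal O}$,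 $J_{\mathcal O}$, $g_{\mathcal O}$ induced by $(\omega,J,g)$ are well defined and smooth, and form a compatible triple on $\mathcal O$. -/

import Mathlib

open Bundle Manifold
open scoped ContDiff

noncomputable section

namespace CompatTriples

section General

variable {E : Type*} [NormedAddCommGroup E] [NormedSpace ℝ E]
  {H : Type*} [TopologicalSpace H] (I : ModelWithCorners ℝ E H)
  {M : Type*} [TopologicalSpace M] [ChartedSpace H M] [IsManifold I ∞ M]
  (F : Type*) [NormedAddCommGroup F] [NormedSpace ℝ F]
  (A : M → Type*) [TopologicalSpace (TotalSpace F A)]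
  [∀ x, TopologicalSpace (A x)] [∀ x, AddCommGroup (A x)] [∀ x, Module ℝ (A x)]
  [∀ x, IsTopologicalAddGroup (A x)] [∀ x, ContinuousSMul ℝ (A x)]
  [FiberBundle F A] [VectorBundle ℝ F A]

/-- The directional derivative `v · f` of a real function along a tangent vector. -/
def dirDeriv {M : Type*} [TopologicalSpace M] [ChartedSpace H M]
    (f : M → ℝ) (x : M) (v : TangentSpace I x) : ℝ :=
  mfderiv I 𝓘(ℝ, ℝ) f x v

/-- The product of a smooth function and a smooth section. -/
def smulSection {I : ModelWithCorners ℝ E H} {F : Type*} [NormedAddCommGroup F] [NormedSpace ℝ F]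
    {M : Type*} [TopologicalSpace M] [ChartedSpace H M]
    {A : M → Type*} [TopologicalSpace (TotalSpace F A)]
    [∀ x, TopologicalSpace (A x)] [∀ x, AddCommGroup (A x)] [∀ x, Module ℝ (A x)]
    [FiberBundle F A] [VectorBundle ℝ F A]
    (f : C^∞⟮I, M; 𝓘(ℝ, ℝ), ℝ⟯) (s : Cₛ^∞⟮I; F, A⟯) : Cₛ^∞⟮I; F, A⟯ :=
  ⟨fun x => f x • s x, f.contMDiff.smul_section s.contMDiff⟩

/-- A Lie algebroid structure on the smooth vector bundle `A → M` with model fibre `F`: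
a real Lie algebra structure on the smooth sections and a smooth bundle map `ρ : A → TM`
compatible with the brackets and satisfying the Leibniz identity. -/
structure LieAlgebroid where
  bracket : Cₛ^∞⟮I; F, A⟯ →ₗ[ℝ] Cₛ^∞⟮I; F, A⟯ →ₗ[ℝ] Cₛ^∞⟮I; F, A⟯
  bracket_self : ∀ s, bracket s s = 0
  jacobi : ∀ s t u,
    bracket s (bracket t u) = bracket (bracket s t) u + bracket t (bracket s u)
  anchor : ∀ x : M, A x →L[ℝ] TangentSpace I x
  contMDiff_anchor : ContMDiff I (I.prod 𝓘(ℝ, F →L[ℝ] E)) ∞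
    (fun x => TotalSpace.mk' (F →L[ℝ] E) (E := fun x : M => A x →L[ℝ] TangentSpace I x)
      x (anchor x))
  anchor_bracket : ∀ s t x, anchor x (bracket s t x) =
    VectorField.mlieBracket I (fun y => anchor y (s y)) (fun y => anchor y (t y)) x
  leibniz : ∀ (s : Cₛ^∞⟮I; F, A⟯) (f : C^∞⟮I, M; 𝓘(ℝ, ℝ), ℝ⟯) (t : Cₛ^∞⟮I; F, A⟯) (x : M),
    bracket s (smulSection f t) x
      = f x • bracket s t x + dirDeriv I f x (anchor x (s x)) • t x

/-- A smooth 2-form on the bundle `A`. -/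
structure TwoForm where
  toFun : ∀ x : M, A x →L[ℝ] A x →L[ℝ] ℝ
  alternating : ∀ x v, toFun x v v = 0
  contMDiff : ContMDiff I (I.prod 𝓘(ℝ, F →L[ℝ] F →L[ℝ] ℝ)) ∞
    (fun x => TotalSpace.mk' (F →L[ℝ] F →L[ℝ] ℝ) (E := fun x : M => A x →L[ℝ] A x →L[ℝ] ℝ)
      x (toFun x))

/-- An almost complex structure on the bundle `A`: a smooth endomorphism with `J² = -id`. -/
structure AlmostComplexStructure where
  toFun : ∀ x : M, A x →L[ℝ] A x
  contMDiff : ContMDiff I (I.prod 𝓘(ℝ, F →L[ℝ] F)) ∞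
    (fun x => TotalSpace.mk' (F →L[ℝ] F) (E := fun x : M => A x →L[ℝ] A x) x (toFun x))
  sq_eq_neg : ∀ x v, toFun x (toFun x v) = -v

variable {I F A}

/-- The exterior derivative `d^A η (s₀, s₁, s₂)` of a 2-form, evaluated on smooth sections. -/
def LieAlgebroid.extDeriv (𝒜 : LieAlgebroid I F A) (η : TwoForm I F A)
    (s₀ s₁ s₂ : Cₛ^∞⟮I; F, A⟯) (x : M) : ℝ :=
  dirDeriv I (fun y => η.toFun y (s₁ y) (s₂ y)) x (𝒜.anchor x (s₀ x))
    - dirDeriv I (fun y => η.toFun y (s₀ y) (s₂ y)) x (𝒜.anchor x (s₁ x))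
    + dirDeriv I (fun y => η.toFun y (s₀ y) (s₁ y)) x (𝒜.anchor x (s₂ x))
    - η.toFun x (𝒜.bracket s₀ s₁ x) (s₂ x)
    + η.toFun x (𝒜.bracket s₀ s₂ x) (s₁ x)
    - η.toFun x (𝒜.bracket s₁ s₂ x) (s₀ x)

/-- A 2-form on a Lie algebroid is symplectic if it is closed and nondegenerate. -/
structure LieAlgebroid.IsSymplectic (𝒜 : LieAlgebroid I F A) (η : TwoForm I F A) : Prop where
  closed : ∀ s₀ s₁ s₂ x, 𝒜.extDeriv η s₀ s₁ s₂ x = 0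
  nondegenerate : ∀ x v, (∀ w, η.toFun x v w = 0) → v = 0

/-- A compatible triple `(ω, J, g)` on a Lie algebroid. -/
structure CompatibleTriple (𝒜 : LieAlgebroid I F A) where
  form : TwoForm I F A
  J : AlmostComplexStructure I F A
  g : ContMDiffRiemannianMetric I ∞ F A
  isSymplectic : 𝒜.IsSymplectic form
  g_J_J : ∀ x v w, g.inner x (J.toFun x v) (J.toFun x w) = g.inner x v w
  form_eq : ∀ x v w, form.toFun x v w = g.inner x v (J.toFun x w)

/-- The orthogonal complement of `W` for the bilinear form `B`. -/
def orth {V : Type*} [TopologicalSpace V] [AddCommGroup V] [Module ℝ V]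
    [IsTopologicalAddGroup V] [ContinuousSMul ℝ V]
    (B : V →L[ℝ] V →L[ℝ] ℝ) (W : Submodule ℝ V) : Submodule ℝ V where
  carrier := {v | ∀ w ∈ W, B v w = 0}
  add_mem' {a b} ha hb w hw := by
    rw [map_add, _root_.add_apply, ha w hw, hb w hw, add_zero]
  zero_mem' w _ := by simp
  smul_mem' c a ha w hw := by
    rw [map_smul, _root_.smul_apply, ha w hw, smul_zero]

namespace CompatibleTriple

variable {𝒜 : LieAlgebroid I F A} (T : CompatibleTriple 𝒜) (p : M)

/-- The kernel `L_p` of the anchor. -/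
def L (_T : CompatibleTriple 𝒜) (p : M) : Submodule ℝ (A p) :=
  LinearMap.ker (𝒜.anchor p : A p →ₗ[ℝ] TangentSpace I p)

/-- `L¹ = L ∩ L^ω`. -/
def L1 : Submodule ℝ (A p) := T.L p ⊓ orth (T.form.toFun p) (T.L p)

/-- `L²` is the `g`-orthogonal complement of `L¹` in `L`. -/
def L2 : Submodule ℝ (A p) := T.L p ⊓ orth (T.g.inner p) (T.L1 p)

/-- `E¹ = J(L¹)`. -/
def E1 : Submodule ℝ (A p) := (T.L1 p).map (T.J.toFun p : A p →ₗ[ℝ] A p)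

/-- `E² = (L + E¹)^ω`. -/
def E2 : Submodule ℝ (A p) := orth (T.form.toFun p) (T.L p ⊔ T.E1 p)

/-- The symplectic generalized distribution `Λ = ρ(E² + L¹)`. -/
def Λ : Submodule ℝ (TangentSpace I p) :=
  (T.E2 p ⊔ T.L1 p).map (𝒜.anchor p : A p →ₗ[ℝ] TangentSpace I p)

end CompatibleTriple

end General

section Tangent

variable {E : Type*} [NormedAddCommGroup E] [NormedSpace ℝ E]
  {H : Type*} [TopologicalSpace H] (I : ModelWithCorners ℝ E H)
  (O : Type*) [TopologicalSpace O] [ChartedSpace H O] [IsManifold I ∞ O]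

theorem contMDiff_tangent_id :
    ContMDiff I (I.prod 𝓘(ℝ, E →L[ℝ] E)) ∞
      (fun x => TotalSpace.mk' (E →L[ℝ] E)
        (E := fun x : O => TangentSpace I x →L[ℝ] TangentSpace I x)
        x (ContinuousLinearMap.id ℝ (TangentSpace I x))) := by
  intro x₀
  rw [contMDiffAt_hom_bundle]
  refine ⟨contMDiffAt_id, ?_⟩
  refine (contMDiffAt_const (c := ContinuousLinearMap.id ℝ E)).congr_of_eventuallyEq ?_
  have hb := (trivializationAt E (TangentSpace I : O → Type _) x₀).open_baseSet.mem_nhds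
    (FiberBundle.mem_baseSet_trivializationAt' x₀)
  filter_upwards [hb] with x hx
  ext v
  have h := (trivializationAt E (TangentSpace I : O → Type _) x₀).linearMapAt_symmₗ (R := ℝ) hx v
  simp only [ContinuousLinearMap.inCoordinates, ContinuousLinearMap.id_comp]
  exact h

/-- The tangent bundle as a Lie algebroid: the anchor is the identity and the bracket is the Lie
bracket of vector fields. -/
def tangentLieAlgebroid [FiniteDimensional ℝ E] :
    LieAlgebroid I E (fun x : O => TangentSpace I x) where
  bracket := LinearMap.mk₂ ℝ
    (fun s t => ⟨VectorField.mlieBracket I s t, by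
      have := FiniteDimensional.complete ℝ E
      have : IsManifold I (minSmoothness ℝ 2) O := by
        rw [minSmoothness_of_isRCLikeNormedField]; infer_instance
      have : IsManifold I (((⊤ : ℕ∞) : ℕ∞ω) + 1) O := ‹IsManifold I ∞ O›
      exact ContDiff.mlieBracket_vectorField (n := (⊤ : ℕ∞)) (m := (⊤ : ℕ∞))
        s.contMDiff t.contMDiff (by
          rw [minSmoothness_of_isRCLikeNormedField]; exact le_rfl)⟩)
    (fun s s' t => by
      have := FiniteDimensional.complete ℝ E
      ext x
      exact VectorField.mlieBracket_add_left s.mdifferentiableAt s'.mdifferentiableAt)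
    (fun c s t => by
      have := FiniteDimensional.complete ℝ E
      ext x
      exact VectorField.mlieBracket_const_smul_left s.mdifferentiableAt)
    (fun s t t' => by
      have := FiniteDimensional.complete ℝ E
      ext x
      exact VectorField.mlieBracket_add_right t.mdifferentiableAt t'.mdifferentiableAt)
    (fun c s t => by
      have := FiniteDimensional.complete ℝ E
      ext x
      exact VectorField.mlieBracket_const_smul_right t.mdifferentiableAt)
  bracket_self s := by
    ext x
    simp
  jacobi s t u := by
    have := FiniteDimensional.complete ℝ E
    have : IsManifold I (minSmoothness ℝ 3) O := by
      rw [minSmoothness_of_isRCLikeNormedField]; infer_instance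
    have h2 : minSmoothness ℝ 2 ≤ ∞ := by
      rw [minSmoothness_of_isRCLikeNormedField]; exact WithTop.coe_le_coe.2 (le_top : (2 : ℕ∞) ≤ ⊤)
    ext x
    exact VectorField.leibniz_identity_mlieBracket_apply
      (s.contMDiff.of_le h2 x) (t.contMDiff.of_le h2 x) (u.contMDiff.of_le h2 x)
  anchor x := ContinuousLinearMap.id ℝ (TangentSpace I x)
  contMDiff_anchor := contMDiff_tangent_id I O
  anchor_bracket s t x := rfl
  leibniz s f t x := by
    have := FiniteDimensional.complete ℝ E
    have hf : MDifferentiableAt I 𝓘(ℝ, ℝ) f x := f.contMDiff.mdifferentiable (by simp) x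
    have h := VectorField.mlieBracket_smul_right (V := s) (W := t) hf t.mdifferentiableAt
    exact h.trans (add_comm _ _)

end Tangent

section Submanifold

variable {E : Type*} [NormedAddCommGroup E] [NormedSpace ℝ E]
  {H : Type*} [TopologicalSpace H] {I : ModelWithCorners ℝ E H}
  {M : Type*} [TopologicalSpace M] [ChartedSpace H M] [IsManifold I ∞ M]
  {F : Type*} [NormedAddCommGroup F] [NormedSpace ℝ F]
  {A : M → Type*} [TopologicalSpace (TotalSpace F A)]
  [∀ x, TopologicalSpace (A x)] [∀ x, AddCommGroup (A x)] [∀ x, Module ℝ (A x)]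
  [∀ x, IsTopologicalAddGroup (A x)] [∀ x, ContinuousSMul ℝ (A x)]
  [FiberBundle F A] [VectorBundle ℝ F A]
  {E' : Type*} [NormedAddCommGroup E'] [NormedSpace ℝ E']
  {H' : Type*} [TopologicalSpace H'] (I' : ModelWithCorners ℝ E' H')
  {O : Type*} [TopologicalSpace O] [ChartedSpace H' O]

/-- `ι : O → M` exhibits `O` as an (immersed) integral submanifold of the generalized
distribution `D` on `M`: it is an injective immersion and `T_q O = D_{ι(q)}` for all `q`. -/
structure IsIntegralSubmanifold (D : ∀ p : M, Submodule ℝ (TangentSpace I p)) (ι : O → M) :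
    Prop where
  contMDiff : ContMDiff I' I ∞ ι
  injective : Function.Injective ι
  injective_mfderiv : ∀ q, Function.Injective (mfderiv I' I ι q)
  range_mfderiv : ∀ q, LinearMap.range
    (mfderiv I' I ι q : TangentSpace I' q →ₗ[ℝ] TangentSpace I (ι q)) = D (ι q)

/-- `S = (ω_O, J_O, g_O)` is induced on `O` by the triple `T = (ω, J, g)` along `ι : O → M`:
`ω_O(X, Y) = ω(a, b)` for all `a, b ∈ E² + L¹` with `ρ(a) = X`, `ρ(b) = Y`, and
`J_O(X) = ρ(J a)`, `g_O(X, Y) = g(a, b)` for all `a, b ∈ E²` with `ρ(a) = X`, `ρ(b) = Y`.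
Tangent vectors of `O` are regarded as tangent vectors of `M` through the differential of `ι`. -/
structure IsInducedTriple [IsManifold I' ∞ O] {𝒜 : LieAlgebroid I F A} (T : CompatibleTriple 𝒜)
    (ι : O → M) {ℬ : LieAlgebroid I' E' (fun q : O => TangentSpace I' q)}
    (S : CompatibleTriple ℬ) : Prop where
  form_eq : ∀ (q : O) (X Y : TangentSpace I' q) (a b : A (ι q)),
    a ∈ T.E2 (ι q) ⊔ T.L1 (ι q) → b ∈ T.E2 (ι q) ⊔ T.L1 (ι q) →
    𝒜.anchor (ι q) a = mfderiv I' I ι q X → 𝒜.anchor (ι q) b = mfderiv I' I ι q Y →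
    S.form.toFun q X Y = T.form.toFun (ι q) a b
  J_eq : ∀ (q : O) (X : TangentSpace I' q) (a : A (ι q)), a ∈ T.E2 (ι q) →
    𝒜.anchor (ι q) a = mfderiv I' I ι q X →
    mfderiv I' I ι q (S.J.toFun q X) = 𝒜.anchor (ι q) (T.J.toFun (ι q) a)
  g_eq : ∀ (q : O) (X Y : TangentSpace I' q) (a b : A (ι q)),
    a ∈ T.E2 (ι q) → b ∈ T.E2 (ι q) →
    𝒜.anchor (ι q) a = mfderiv I' I ι q X → 𝒜.anchor (ι q) b = mfderiv I' I ι q Y →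
    S.g.inner q X Y = T.g.inner (ι q) a b

end Submanifold

end CompatTriples

end

namespace CompatTriples

/-! The pointwise part is linear algebra. Removing from `a ∈ L^ω` its `g`-projection to `L¹` leaves
an element of `E²`, because `ω(·, J l) = -g(·, l)`. Hence `E² + L¹ = L^ω` (`E2_sup_L1`) and `Λ =
ρ(L^ω)`. If `J(L²) ⊆ L²`, then `E²` is `g`-orthogonal to all of `L = L¹ + L²` (`g_E2_L`). It follows
that `E²` is `J`-invariant, that `ρ` is injective on `E²`, and that each tangent vector `X` of `O`
has a unique lift `σ X ∈ E²`. The induced tensors are the pullbacks of `ω`, `J`, `g` along `σ`.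

Smoothness means smoothness of `σ`. In coordinates `σ X` is the solution of a linear system, `ρ(l) =
X` and `l ⊥ ker ρ`, which depends smoothly on the point as soon as `ρ` has locally constant rank
along `O`. To see that it has, note that `L^ω` is spanned by Hamiltonian sections `s`, and `ρ[s, t]
= [ρ s, ρ t]` says that the derivative of the coordinate matrix `R` of `ρ` along `ρ(s)` has the form
`B R + R C`. These directions fill `TO`. With a smooth family `W` of outer inverses, the defect `S =
R - R W(R) R` then satisfies a homogeneous linear differential inequality, so Grönwall's lemma along
segments in a chart of `O` gives `S = 0` (`eventually_comp_outer_inverse`).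

For closedness, on `L^ω` the form depends only on anchors (`form_congr`). Sections of `L^ω` induce
`ι`-related fields on `O`, and on such fields `dω_O` is the restriction of `d^A ω = 0`. They realise
every tangent vector, and `dω_O` is tensorial, so it vanishes identically. -/

theorem exists_orthogonal_projection {V : Type*} [AddCommGroup V] [Module ℝ V]
    [FiniteDimensional ℝ V] (B : LinearMap.BilinForm ℝ V) (hs : ∀ v w, B v w = B w v)
    (hp : ∀ v, v ≠ 0 → 0 < B v v) (W : Submodule ℝ V) (a : V) :
    ∃ w ∈ W, ∀ w' ∈ W, B (a - w) w' = 0 := by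
  have hr : B.IsRefl := fun v w h => by rw [hs]; exact h
  have hd : Disjoint W (B.orthogonal W) := by
    rw [Submodule.disjoint_def]
    intro v hv hv'
    by_contra hne
    exact (hp v hne).ne' (hv' v hv)
  have hc := (LinearMap.BilinForm.isCompl_orthogonal_iff_disjoint hr).2 hd
  obtain ⟨w, hw, u, hu, rfl⟩ :=
    Submodule.mem_sup.1 (hc.sup_eq_top ▸ Submodule.mem_top : a ∈ W ⊔ B.orthogonal W)
  refine ⟨w, hw, fun w' hw' => ?_⟩
  rw [add_sub_cancel_left, hs]
  exact hu w' hw'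

namespace CompatibleTriple

/-! ### Linear algebra in one fibre. -/

section Pointwise

variable {E : Type*} [NormedAddCommGroup E] [NormedSpace ℝ E]
  {H : Type*} [TopologicalSpace H] {I : ModelWithCorners ℝ E H}
  {M : Type*} [TopologicalSpace M] [ChartedSpace H M] [IsManifold I ∞ M]
  {F : Type*} [NormedAddCommGroup F] [NormedSpace ℝ F]
  {A : M → Type*} [TopologicalSpace (TotalSpace F A)]
  [∀ x, TopologicalSpace (A x)] [∀ x, AddCommGroup (A x)] [∀ x, Module ℝ (A x)]
  [∀ x, IsTopologicalAddGroup (A x)] [∀ x, ContinuousSMul ℝ (A x)]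
  [FiberBundle F A] [VectorBundle ℝ F A]
  {𝒜 : LieAlgebroid I F A} (T : CompatibleTriple 𝒜) {p : M}

theorem mem_L {a : A p} : a ∈ T.L p ↔ 𝒜.anchor p a = 0 := Iff.rfl

theorem g_J_left (a b : A p) :
    T.g.inner p (T.J.toFun p a) b = -T.g.inner p a (T.J.toFun p b) := by
  rw [← T.g_J_J p (T.J.toFun p a) b, T.J.sq_eq_neg]
  simp

theorem form_antisymm (a b : A p) : T.form.toFun p a b = -T.form.toFun p b a := by
  rw [T.form_eq, T.form_eq, T.g.symm, g_J_left, T.g.symm]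

theorem form_J_right (a b : A p) : T.form.toFun p a (T.J.toFun p b) = -T.g.inner p a b := by
  rw [T.form_eq, T.J.sq_eq_neg, map_neg]

theorem form_J_J (a b : A p) :
    T.form.toFun p (T.J.toFun p a) (T.J.toFun p b) = T.form.toFun p a b := by
  rw [T.form_eq, T.form_eq, T.g_J_J]

theorem eq_zero_of_g_self {a : A p} (h : T.g.inner p a a = 0) : a = 0 := by
  by_contra hne
  exact (T.g.pos p a hne).ne' h

theorem E2_le_orth_L : T.E2 p ≤ orth (T.form.toFun p) (T.L p) :=
  fun _ ha w hw => ha w (Submodule.mem_sup_left hw)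

theorem L1_le_L : T.L1 p ≤ T.L p := inf_le_left

theorem L1_le_orth_L : T.L1 p ≤ orth (T.form.toFun p) (T.L p) := inf_le_right

theorem form_eq_zero_of_mem_L {a b : A p} (ha : a ∈ orth (T.form.toFun p) (T.L p))
    (hb : b ∈ T.L p) : T.form.toFun p b a = 0 := by
  rw [form_antisymm, ha b hb, neg_zero]

/-- On `L^ω` the form depends only on the anchors. -/
theorem form_congr {a a' b b' : A p} (ha : a ∈ orth (T.form.toFun p) (T.L p))
    (hb' : b' ∈ orth (T.form.toFun p) (T.L p))
    (h : 𝒜.anchor p a = 𝒜.anchor p a') (h' : 𝒜.anchor p b = 𝒜.anchor p b') :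
    T.form.toFun p a b = T.form.toFun p a' b' := by
  have h₁ : T.form.toFun p a (b - b') = 0 := ha _ (T.mem_L.2 (by rw [map_sub, h', sub_self]))
  have h₂ : T.form.toFun p (a - a') b' = 0 :=
    T.form_eq_zero_of_mem_L hb' (T.mem_L.2 (by rw [map_sub, h, sub_self]))
  rw [map_sub, sub_eq_zero] at h₁
  rw [map_sub, sub_apply, sub_eq_zero] at h₂
  rw [h₁, h₂]

/-- Elements of `L^ω` are dual to the covectors of the base. -/
theorem exists_covector [FiniteDimensional ℝ E] {a : A p}
    (ha : a ∈ orth (T.form.toFun p) (T.L p)) :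
    ∃ ξ : TangentSpace I p →ₗ[ℝ] ℝ, ∀ b, T.form.toFun p a b = ξ (𝒜.anchor p b) := by
  have hmem : (T.form.toFun p a : A p →ₗ[ℝ] ℝ) ∈
      (LinearMap.ker (𝒜.anchor p : A p →ₗ[ℝ] TangentSpace I p)).dualAnnihilator := by
    rw [Submodule.mem_dualAnnihilator]
    exact fun w hw => ha w hw
  rw [← LinearMap.range_dualMap_eq_dualAnnihilator_ker] at hmem
  obtain ⟨ξ, hξ⟩ := hmem
  exact ⟨ξ, fun b => (LinearMap.congr_fun hξ b).symm⟩

variable [FiniteDimensional ℝ F]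

theorem exists_g_projection (W : Submodule ℝ (A p)) (a : A p) :
    ∃ w ∈ W, ∀ w' ∈ W, T.g.inner p (a - w) w' = 0 := by
  have : FiniteDimensional ℝ (A p) := VectorBundle.finiteDimensional ℝ F A p
  exact exists_orthogonal_projection
    (LinearMap.mk₂ ℝ (fun v w => T.g.inner p v w) (by simp) (by simp) (by simp) (by simp))
    (T.g.symm p) (T.g.pos p) W a

/-- Take for `l` the `g`-orthogonal projection of `a` to `L¹`. Both `a` and `l` are `ω`-orthogonal
to `L`, and `ω(a - l, J l') = -g(a - l, l')` vanishes for `l' ∈ L¹`. -/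
theorem exists_E2_add_L1 {a : A p} (ha : a ∈ orth (T.form.toFun p) (T.L p)) :
    ∃ l ∈ T.L1 p, a - l ∈ T.E2 p := by
  obtain ⟨l, hl, h⟩ := T.exists_g_projection (T.L1 p) a
  refine ⟨l, hl, ?_⟩
  intro w hw
  obtain ⟨w₁, hw₁, w₂, hw₂, rfl⟩ := Submodule.mem_sup.1 hw
  obtain ⟨l', hl', rfl⟩ := hw₂
  have h₁ : T.form.toFun p (a - l) w₁ = 0 := by
    rw [map_sub, sub_apply, ha _ hw₁, T.L1_le_orth_L hl _ hw₁, sub_zero]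
  have h₂ : T.form.toFun p (a - l) (T.J.toFun p l') = 0 := by
    rw [form_J_right, h _ hl', neg_zero]
  rw [map_add, h₁, zero_add]
  exact h₂

/-- This replaces the metric-dependent `E² + L¹` by `L^ω`, whose elements are `ω`-dual to covectors
of the base and therefore extend to Hamiltonian sections. -/
theorem E2_sup_L1 : T.E2 p ⊔ T.L1 p = orth (T.form.toFun p) (T.L p) := by
  apply le_antisymm (sup_le T.E2_le_orth_L T.L1_le_orth_L)
  intro a ha
  obtain ⟨l, hl, h⟩ := T.exists_E2_add_L1 ha
  exact Submodule.mem_sup.2 ⟨a - l, h, l, hl, sub_add_cancel _ _⟩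

theorem mem_Λ {v : TangentSpace I p} :
    v ∈ T.Λ p ↔ ∃ a ∈ orth (T.form.toFun p) (T.L p), 𝒜.anchor p a = v := by
  rw [Λ, E2_sup_L1]
  rfl

theorem exists_mem_E2 {v : TangentSpace I p} (hv : v ∈ T.Λ p) :
    ∃ a ∈ T.E2 p, 𝒜.anchor p a = v := by
  obtain ⟨a, ha, rfl⟩ := T.mem_Λ.1 hv
  obtain ⟨l, hl, h⟩ := T.exists_E2_add_L1 ha
  refine ⟨a - l, h, ?_⟩
  rw [map_sub, T.mem_L.1 (T.L1_le_L hl), sub_zero]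

section Invariant

variable {T}

/-- Up to sign `g(e, l)` is `ω(e, J l)`. For the `L¹` component of `l` the vector `J l` lies in
`E¹`; for the `L²` component it lies in `L` by `hJ`. An element of `E²` annihilates both. -/
theorem g_E2_L (hJ : ∀ a ∈ T.L2 p, T.J.toFun p a ∈ T.L2 p) {e l : A p}
    (he : e ∈ T.E2 p) (hl : l ∈ T.L p) : T.g.inner p e l = 0 := by
  obtain ⟨l₁, hl₁, h⟩ := T.exists_g_projection (T.L1 p) l
  have h₁ : T.g.inner p e l₁ = 0 := by
    have h₀ : T.form.toFun p e (T.J.toFun p l₁) = 0 :=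
      he _ (Submodule.mem_sup_right ⟨l₁, hl₁, rfl⟩)
    rw [form_J_right] at h₀
    linarith
  have h₂ : T.g.inner p e (l - l₁) = 0 := by
    have hmem : l - l₁ ∈ T.L2 p := ⟨Submodule.sub_mem _ hl (T.L1_le_L hl₁), h⟩
    have h₀ := he _ (Submodule.mem_sup_left (hJ _ hmem).1)
    rw [form_J_right] at h₀
    linarith
  rw [map_sub, h₁, sub_zero] at h₂
  exact h₂

/-- Against `L`, `ω(J e, w) = g(J e, J w) = g(e, w) = 0` by `g_E2_L`; against `J(L¹)`, `ω(J e, J l)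
= ω(e, l) = 0`. -/
theorem J_mem_E2 (hJ : ∀ a ∈ T.L2 p, T.J.toFun p a ∈ T.L2 p) {e : A p}
    (he : e ∈ T.E2 p) : T.J.toFun p e ∈ T.E2 p := by
  intro w hw
  obtain ⟨w₁, hw₁, w₂, ⟨l, hl, rfl⟩, rfl⟩ := Submodule.mem_sup.1 hw
  have h₁ : T.form.toFun p (T.J.toFun p e) w₁ = 0 := by
    rw [T.form_eq, T.g_J_J, g_E2_L hJ he hw₁]
  have h₂ : T.form.toFun p (T.J.toFun p e) (T.J.toFun p l) = 0 := by
    rw [form_J_J]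
    exact T.E2_le_orth_L he _ (T.L1_le_L hl)
  rw [map_add, h₁, zero_add]
  exact h₂

/-- The difference lies in `E² ∩ L`, hence is `g`-orthogonal to itself. -/
theorem eq_of_anchor_eq (hJ : ∀ a ∈ T.L2 p, T.J.toFun p a ∈ T.L2 p) {a b : A p}
    (ha : a ∈ T.E2 p) (hb : b ∈ T.E2 p)
    (h : 𝒜.anchor p a = 𝒜.anchor p b) : a = b := by
  have hL : a - b ∈ T.L p := T.mem_L.2 (by rw [map_sub, h, sub_self])
  exact sub_eq_zero.1 (T.eq_zero_of_g_self (g_E2_L hJ (Submodule.sub_mem _ ha hb) hL))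

end Invariant

end Pointwise

end CompatibleTriple

end CompatTriples

namespace CompatTriples

open Filter Topology

/-! ### Outer inverses, Grönwall's lemma and locally constant rank. -/

section OuterInverse

variable {E F : Type*} [NormedAddCommGroup E] [NormedSpace ℝ E] [FiniteDimensional ℝ E]
  [NormedAddCommGroup F] [NormedSpace ℝ F] [FiniteDimensional ℝ F]

/-- Compose a projection onto the range of `R` with a linear section of `R` over its range. -/
theorem exists_generalized_inverse (R : F →L[ℝ] E) :
    ∃ Q : E →L[ℝ] F, R ∘L Q ∘L R = R ∧ Q ∘L R ∘L Q = Q := by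
  obtain ⟨s, hs⟩ := (R : F →ₗ[ℝ] E).rangeRestrict.exists_rightInverse_of_surjective
    (LinearMap.range_rangeRestrict _)
  obtain ⟨P, hP⟩ := (LinearMap.range (R : F →ₗ[ℝ] E)).subtype.exists_leftInverse_of_injective
    (Submodule.ker_subtype _)
  have hs' : ∀ y : LinearMap.range (R : F →ₗ[ℝ] E), R (s y) = y := fun y =>
    congrArg Subtype.val (LinearMap.congr_fun hs y)
  have hP' : ∀ y : LinearMap.range (R : F →ₗ[ℝ] E), P y = y := fun y => LinearMap.congr_fun hP y
  refine ⟨LinearMap.toContinuousLinearMap (s ∘ₗ P), ?_, ?_⟩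
  · ext v
    change R (s (P (R v))) = R v
    rw [hs', show P (R v) = (⟨R v, v, rfl⟩ : LinearMap.range (R : F →ₗ[ℝ] E)) from
      hP' ⟨R v, v, rfl⟩]
  · ext v
    change s (P (R (s (P v)))) = s (P v)
    rw [hs', hP']

/-- Near a linear map `R₀` there is a smooth family of outer inverses, which at `R₀` is a
generalized inverse. -/
theorem exists_smooth_outer_inverse (R₀ : F →L[ℝ] E) :
    ∃ W : (F →L[ℝ] E) → (E →L[ℝ] F), R₀ ∘L W R₀ ∘L R₀ = R₀ ∧
      (∀ n, ContDiffAt ℝ n W R₀) ∧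
      ∀ᶠ R in 𝓝 R₀, W R ∘L R ∘L W R = W R ∧
        ∃ W' : (F →L[ℝ] E) →L[ℝ] (E →L[ℝ] F), HasFDerivAt W W' R ∧
          ∀ X, W' X = -(W R ∘L X ∘L W R) := by
  obtain ⟨Q, h₁, h₂⟩ := exists_generalized_inverse R₀
  -- The family is `W R = τ(R)⁻¹ Q`. Since `Q R₀ Q = Q`, one has `Q R₀ τ(R) = Q R`, which yields `W
  -- R W = W`; differentiating `τ⁻¹` gives `-W X W`.
  set τ : (F →L[ℝ] E) → (F →L[ℝ] F) := fun R => 1 + Q ∘L (R - R₀) with hτ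
  set W : (F →L[ℝ] E) → (E →L[ℝ] F) := fun R => Ring.inverse (τ R) ∘L Q with hW
  have hτ₀ : τ R₀ = 1 := by simp [hτ]
  have hτs : ContDiff ℝ ⊤ τ := by
    rw [hτ]
    exact contDiff_const.add (contDiff_const.clm_comp (contDiff_id.sub contDiff_const))
  have hτd : ∀ R, HasFDerivAt τ (ContinuousLinearMap.compL ℝ F E F Q) R := by
    intro R
    have : HasFDerivAt (fun R : F →L[ℝ] E => R - R₀) (ContinuousLinearMap.id ℝ _) R :=
      (hasFDerivAt_id R).sub_const R₀
    exact ((ContinuousLinearMap.compL ℝ F E F Q).hasFDerivAt.comp R this).const_add 1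
  refine ⟨W, ?_, ?_, ?_⟩
  · simp only [hW, hτ₀, Ring.inverse_one]
    exact h₁
  · intro n
    have hi : ContDiffAt ℝ n Ring.inverse (τ R₀) := by
      rw [hτ₀]
      exact contDiffAt_ringInverse ℝ (1 : (F →L[ℝ] F)ˣ)
    exact (hi.comp R₀ (hτs.of_le le_top).contDiffAt).clm_comp contDiffAt_const
  · have hu : ∀ᶠ R in 𝓝 R₀, IsUnit (τ R) := by
      have : {T : F →L[ℝ] F | IsUnit T} ∈ 𝓝 (τ R₀) :=
        Units.isOpen.mem_nhds (by rw [hτ₀]; exact isUnit_one)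
      exact hτs.continuous.continuousAt this
    filter_upwards [hu] with R hR
    obtain ⟨u, hu⟩ := hR
    have hWR : W R = (↑u⁻¹ : F →L[ℝ] F) ∘L Q := by
      simp only [hW, ← hu, Ring.inverse_unit]
    have hZ : (Q ∘L R₀) * u = Q ∘L R := by
      rw [hu]
      ext v
      have h₂' : ∀ y, Q (R₀ (Q y)) = Q y := fun y => DFunLike.congr_fun h₂ y
      simp [hτ, h₂']
    have hZ' : Q ∘L R₀ = (Q ∘L R) * (↑u⁻¹ : F →L[ℝ] F) := by
      rw [← hZ, mul_assoc, Units.mul_inv, mul_one]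
    refine ⟨?_, ?_⟩
    · rw [hWR]
      ext v
      have := DFunLike.congr_fun hZ' (Q v)
      have h₂' : Q (R₀ (Q v)) = Q v := DFunLike.congr_fun h₂ v
      simp only [ContinuousLinearMap.comp_apply, mul_apply_eq_comp] at this ⊢
      rw [← this, h₂']
    · have hi : HasFDerivAt Ring.inverse
          (-ContinuousLinearMap.mulLeftRight ℝ (F →L[ℝ] F) ↑u⁻¹ ↑u⁻¹) (τ R) := by
        rw [← hu]
        exact hasFDerivAt_ringInverse u
      have hd := (((ContinuousLinearMap.compL ℝ E F F).flip Q).hasFDerivAt).comp R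
        (hi.comp R (hτd R))
      refine ⟨_, hd, fun X => ?_⟩
      rw [hWR]
      ext v
      simp only [ContinuousLinearMap.comp_apply, ContinuousLinearMap.flip_apply,
        ContinuousLinearMap.compL_apply, neg_apply, ContinuousLinearMap.mulLeftRight_apply,
        mul_apply_eq_comp]

end OuterInverse

section Gronwall

variable {E G : Type*} [NormedAddCommGroup E] [NormedSpace ℝ E]
  [NormedAddCommGroup G] [NormedSpace ℝ G]

/-- Grönwall's inequality on each segment issuing from `x₀` inside a ball where both hypotheses
hold. -/
theorem eventually_eq_zero_of_norm_fderiv_le {h : E → G} {x₀ : E} {K : ℝ} (h₀ : h x₀ = 0)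
    (hd : ∀ᶠ x in 𝓝 x₀, DifferentiableAt ℝ h x)
    (hK : ∀ᶠ x in 𝓝 x₀, ∀ u, ‖fderiv ℝ h x u‖ ≤ K * ‖u‖ * ‖h x‖) :
    ∀ᶠ x in 𝓝 x₀, h x = 0 := by
  obtain ⟨r, hr, hball⟩ := Metric.eventually_nhds_iff_ball.1 (hd.and hK)
  refine Metric.eventually_nhds_iff_ball.2 ⟨r, hr, fun x hx => ?_⟩
  have hmem : ∀ t ∈ Set.Icc (0 : ℝ) 1, x₀ + t • (x - x₀) ∈ Metric.ball x₀ r := by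
    intro t ht
    rw [mem_ball_iff_norm] at hx ⊢
    rw [add_sub_cancel_left, norm_smul, Real.norm_of_nonneg ht.1]
    nlinarith [norm_nonneg (x - x₀), ht.2]
  have hder : ∀ t ∈ Set.Icc (0 : ℝ) 1, HasDerivAt (fun t : ℝ => h (x₀ + t • (x - x₀)))
      (fderiv ℝ h (x₀ + t • (x - x₀)) (x - x₀)) t := by
    intro t ht
    have h₁ : HasDerivAt (fun t : ℝ => x₀ + t • (x - x₀)) (x - x₀) t := by
      simpa using ((hasDerivAt_id t).smul_const (x - x₀)).const_add x₀
    exact ((hball _ (hmem t ht)).1.hasFDerivAt).comp_hasDerivAt t h₁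
  have := eq_zero_of_abs_deriv_le_mul_abs_self_of_eq_zero_right
    (f := fun t : ℝ => h (x₀ + t • (x - x₀))) (K := K * ‖x - x₀‖) (a := 0) (b := 1)
    (fun t ht => (hder t ht).continuousAt.continuousWithinAt)
    (fun t ht => (hder t (Set.Ico_subset_Icc_self ht)).hasDerivWithinAt) (by simpa using h₀)
    (fun t ht => (hball _ (hmem t (Set.Ico_subset_Icc_self ht))).2 (x - x₀)) 1
    (Set.right_mem_Icc.2 zero_le_one)
  simpa using this

end Gronwall

section ConstantRank

variable {E E' F : Type*} [NormedAddCommGroup E] [NormedSpace ℝ E]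
  [NormedAddCommGroup E'] [NormedSpace ℝ E']
  [NormedAddCommGroup F] [NormedSpace ℝ F]

/-- If the derivatives of a family of linear maps `R x` have the form `B ∘ R x + R x ∘ C`, then the
rank of `R x` is locally constant: the outer inverse of `R x` is a generalized inverse. -/
theorem eventually_comp_outer_inverse {R : E' → F →L[ℝ] E} {x₀ : E'} {K : ℝ}
    (hc : ContinuousAt R x₀) (hd : ∀ᶠ x in 𝓝 x₀, DifferentiableAt ℝ R x)
    (hK : ∀ᶠ x in 𝓝 x₀, ∀ u, ∃ (B : E →L[ℝ] E) (C : F →L[ℝ] F), ‖B‖ ≤ K * ‖u‖ ∧ ‖C‖ ≤ K * ‖u‖ ∧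
      fderiv ℝ R x u = B ∘L R x + R x ∘L C)
    {W : (F →L[ℝ] E) → (E →L[ℝ] F)} (hW₀ : R x₀ ∘L W (R x₀) ∘L R x₀ = R x₀)
    (hWc : ContinuousAt W (R x₀))
    (hW : ∀ᶠ R in 𝓝 (R x₀), W R ∘L R ∘L W R = W R ∧
        ∃ W' : (F →L[ℝ] E) →L[ℝ] (E →L[ℝ] F), HasFDerivAt W W' R ∧
          ∀ X, W' X = -(W R ∘L X ∘L W R)) :
    ∀ᶠ x in 𝓝 x₀, R x ∘L W (R x) ∘L R x = R x := by
  set U : E' → E →L[ℝ] E := fun x => 1 - R x ∘L W (R x) with hU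
  set V : E' → F →L[ℝ] F := fun x => 1 - W (R x) ∘L R x with hV
  set S : E' → F →L[ℝ] E := fun x => R x - R x ∘L W (R x) ∘L R x with hS
  have hWR : ContinuousAt (fun x => W (R x)) x₀ := ContinuousAt.comp hWc hc
  have hUc : ContinuousAt U x₀ := continuousAt_const.sub (hc.clm_comp hWR)
  have hVc : ContinuousAt V x₀ := continuousAt_const.sub (hWR.clm_comp hc)
  have hUb : ∀ᶠ x in 𝓝 x₀, ‖U x‖ < ‖U x₀‖ + 1 :=
    hUc.norm.eventually_lt continuousAt_const (lt_add_one _)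
  have hVb : ∀ᶠ x in 𝓝 x₀, ‖V x‖ < ‖V x₀‖ + 1 :=
    hVc.norm.eventually_lt continuousAt_const (lt_add_one _)
  -- With `W' X = -W X W`, differentiating `R - R W R` gives `R' - R' W R + R W R' W R - R W R'`,
  -- which factors as `(1 - R W) R' (1 - W R)`.
  have hSder : ∀ᶠ x in 𝓝 x₀, ∃ S' : E' →L[ℝ] F →L[ℝ] E, HasFDerivAt S S' x ∧
      ∀ u, S' u = U x ∘L fderiv ℝ R x u ∘L V x := by
    filter_upwards [hd, hc.eventually hW] with x hx ⟨hWx, W', hW', hW'X⟩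
    have h₁ := hx.hasFDerivAt
    have h₂ : HasFDerivAt (fun x => W (R x)) (W' ∘L fderiv ℝ R x) x := hW'.comp x h₁
    refine ⟨_, h₁.sub (h₁.clm_comp (h₂.clm_comp h₁)), fun u => ?_⟩
    ext v
    have e : ∀ y, W (R x) (R x (W (R x) y)) = W (R x) y := fun y =>
      DFunLike.congr_fun hWx y
    simp only [hU, hV, hW'X, sub_apply, add_apply, neg_apply, ContinuousLinearMap.comp_apply,
      ContinuousLinearMap.compL_apply, ContinuousLinearMap.flip_apply, map_sub, map_neg, map_add,
      one_apply_eq_self]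
    abel
  have hS₀ : S x₀ = 0 := by simp only [hS, hW₀, sub_self]
  have key := eventually_eq_zero_of_norm_fderiv_le (h := S) (x₀ := x₀)
    (K := (‖U x₀‖ + 1) * K + K * (‖V x₀‖ + 1)) hS₀
    (hSder.mono fun x ⟨S', h, _⟩ => h.differentiableAt) ?_
  · filter_upwards [key] with x hx
    exact (sub_eq_zero.1 hx).symm
  · filter_upwards [hSder, hK, hUb, hVb] with x ⟨S', hS', hS'u⟩ hKx hUx hVx u
    obtain ⟨B, C, hB, hC, hBC⟩ := hKx u
    -- Both `U R` and `R V` equal `S`, so substituting `R' = B R + R C` in `U R' V` leaves an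
    -- expression linear in `S`.
    have e : fderiv ℝ S x u = (U x ∘L B) ∘L S x + S x ∘L (C ∘L V x) := by
      rw [hS'.fderiv, hS'u, hBC]
      ext v
      simp [hU, hV, hS]
      abel
    have hKu : 0 ≤ K * ‖u‖ := (norm_nonneg B).trans hB
    rw [e]
    calc ‖(U x ∘L B) ∘L S x + S x ∘L (C ∘L V x)‖
        ≤ ‖(U x ∘L B) ∘L S x‖ + ‖S x ∘L (C ∘L V x)‖ := norm_add_le _ _
      _ ≤ (‖U x‖ * ‖B‖) * ‖S x‖ + ‖S x‖ * (‖C‖ * ‖V x‖) := by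
          gcongr
          · exact (ContinuousLinearMap.opNorm_comp_le _ _).trans
              (by gcongr; exact ContinuousLinearMap.opNorm_comp_le _ _)
          · exact (ContinuousLinearMap.opNorm_comp_le _ _).trans
              (by gcongr; exact ContinuousLinearMap.opNorm_comp_le _ _)
      _ ≤ ((‖U x₀‖ + 1) * (K * ‖u‖)) * ‖S x‖ + ‖S x‖ * ((K * ‖u‖) * (‖V x₀‖ + 1)) := by
          gcongr
      _ = _ := by ring

variable [FiniteDimensional ℝ E'] [FiniteDimensional ℝ E]

/-- A family of solutions `c` of `X x c = D x u` that is bounded locally uniformly in `x`. -/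
theorem eventually_exists_bounded_preimage {X : Type*} [TopologicalSpace X] {x₀ : X}
    {D : X → E' →L[ℝ] E} {Y : X → F →L[ℝ] E} (hD : ContinuousAt D x₀) (hY : ContinuousAt Y x₀)
    (hinj : Function.Injective (D x₀))
    (hr : ∀ᶠ x in 𝓝 x₀, ∀ v, (∃ u, D x u = v) ↔ ∃ c, Y x c = v) :
    ∃ K : ℝ, ∀ᶠ x in 𝓝 x₀, ∀ u, ∃ c, Y x c = D x u ∧ ‖c‖ ≤ K * ‖u‖ := by
  obtain ⟨P, hP⟩ := (D x₀ : E' →ₗ[ℝ] E).exists_leftInverse_of_injective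
    (LinearMap.ker_eq_bot.2 hinj)
  obtain ⟨κ, hκ⟩ : ∃ κ : E' →ₗ[ℝ] F, (Y x₀ : F →ₗ[ℝ] E) ∘ₗ κ = D x₀ := by
    obtain ⟨κ, hκ⟩ := Module.projective_lifting_property (Y x₀ : F →ₗ[ℝ] E).rangeRestrict
      ((D x₀ : E' →ₗ[ℝ] E).codRestrict (LinearMap.range (Y x₀ : F →ₗ[ℝ] E))
        fun u => (hr.self_of_nhds _).1 ⟨u, rfl⟩) (LinearMap.surjective_rangeRestrict _)
    exact ⟨κ, LinearMap.ext fun u => congrArg Subtype.val (LinearMap.congr_fun hκ u)⟩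
  set P' : E →L[ℝ] E' := LinearMap.toContinuousLinearMap P
  set κ' : E' →L[ℝ] F := LinearMap.toContinuousLinearMap κ
  -- At `x₀`, `κ` solves `Y κ = D` and `P` is a left inverse of `D`, so `N x₀ = 1` and `N x` is
  -- invertible nearby. The candidate solution is `Ξ = κ N⁻¹ P D`, continuous at `x₀`, hence bounded
  -- near it.
  set N : X → E' →L[ℝ] E' := fun x => P' ∘L Y x ∘L κ' with hN
  have hNc : ContinuousAt N x₀ := continuousAt_const.clm_comp (hY.clm_comp continuousAt_const)
  have hDc : ContinuousAt (fun x => P' ∘L D x) x₀ := continuousAt_const.clm_comp hD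
  have hP₀ : P' ∘L D x₀ = 1 := by
    ext v
    exact LinearMap.congr_fun hP v
  have hN₀ : N x₀ = 1 := by
    rw [← hP₀]
    ext v
    exact congrArg P' (LinearMap.congr_fun hκ v)
  have hopen : ∀ T : X → E' →L[ℝ] E', ContinuousAt T x₀ → T x₀ = 1 →
      ∀ᶠ x in 𝓝 x₀, IsUnit (T x) := fun T hT h1 =>
    hT (Units.isOpen.mem_nhds (by rw [h1]; exact isUnit_one))
  set Ξ : X → E' →L[ℝ] F := fun x => κ' ∘L Ring.inverse (N x) ∘L (P' ∘L D x) with hΞ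
  have hΞc : ContinuousAt Ξ x₀ := by
    refine continuousAt_const.clm_comp (ContinuousAt.clm_comp ?_ hDc)
    have : ContinuousAt Ring.inverse (N x₀) := by
      rw [hN₀]
      exact NormedRing.inverse_continuousAt (1 : (E' →L[ℝ] E')ˣ)
    exact ContinuousAt.comp this hNc
  have hΞb : ∀ᶠ x in 𝓝 x₀, ‖Ξ x‖ < ‖Ξ x₀‖ + 1 :=
    hΞc.norm.eventually_lt continuousAt_const (lt_add_one _)
  refine ⟨‖Ξ x₀‖ + 1, ?_⟩
  filter_upwards [hr, hopen N hNc hN₀, hopen _ hDc hP₀, hΞb] with x hx hNx hDx hb u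
  refine ⟨Ξ x u, ?_, (ContinuousLinearMap.le_opNorm _ _).trans (by gcongr)⟩
  -- By construction `Y Ξ u` and `D u` agree only after applying `P`. Equality of the ranges puts `Y
  -- Ξ u` in the range of `D x`, where `P` is injective because `P D x` is invertible.
  obtain ⟨w, hw⟩ := (hx (Y x (Ξ x u))).2 ⟨_, rfl⟩
  have h₁ : N x * Ring.inverse (N x) = 1 := Ring.mul_inverse_cancel _ hNx
  have h₂ : P' (Y x (Ξ x u)) = P' (D x u) := DFunLike.congr_fun h₁ (P' (D x u))
  rw [← hw] at h₂ ⊢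
  obtain ⟨d, hd⟩ := hDx
  have : w = u := by
    have e : (↑d⁻¹ : E' →L[ℝ] E') * (P' ∘L D x) = 1 := by rw [← hd, Units.inv_mul]
    have e' : ∀ y, (↑d⁻¹ : E' →L[ℝ] E') (P' (D x y)) = y := fun y =>
      DFunLike.congr_fun e y
    rw [← e' w, h₂, e']
  rw [this]

end ConstantRank

end CompatTriples

namespace CompatTriples

open Filter Topology VectorField

/-! ### Lie brackets of vector fields as commutators, computed in a chart. -/

section Commutator

variable {E : Type*} [NormedAddCommGroup E] [NormedSpace ℝ E]
  {H : Type*} [TopologicalSpace H] {I : ModelWithCorners ℝ E H} [I.Boundaryless]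
  {M : Type*} [TopologicalSpace M] [ChartedSpace H M] [IsManifold I ∞ M]
  {G : Type*} [NormedAddCommGroup G] [NormedSpace ℝ G]

theorem contMDiffAt_extChartAt_symm {x : M} {y : E} (hy : y ∈ (extChartAt I x).target) :
    ContMDiffAt 𝓘(ℝ, E) I ∞ (extChartAt I x).symm y :=
  (contMDiffOn_extChartAt_symm x).contMDiffAt ((isOpen_extChartAt_target x).mem_nhds hy)

theorem mdifferentiableAt_extChartAt_symm {x : M} {y : E} (hy : y ∈ (extChartAt I x).target) :
    MDifferentiableAt 𝓘(ℝ, E) I (extChartAt I x).symm y :=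
  (contMDiffAt_extChartAt_symm hy).mdifferentiableAt (by simp)

theorem isInvertible_mfderiv_extChartAt_symm {x : M} {y : E} (hy : y ∈ (extChartAt I x).target) :
    (mfderiv 𝓘(ℝ, E) I (extChartAt I x).symm y).IsInvertible := by
  have := isInvertible_mfderivWithin_extChartAt_symm (I := I) hy
  rwa [I.range_eq_univ, mfderivWithin_univ] at this

theorem fderiv_comp_extChartAt_symm {f : M → G} {x : M} {y : E}
    (hy : y ∈ (extChartAt I x).target)
    (hf : MDifferentiableAt I 𝓘(ℝ, G) f ((extChartAt I x).symm y)) (u : E) :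
    fderiv ℝ (f ∘ (extChartAt I x).symm) y u =
      mvfderiv I f ((extChartAt I x).symm y)
        (mfderiv 𝓘(ℝ, E) I (extChartAt I x).symm y u) := by
  rw [← mfderiv_eq_fderiv, mfderiv_comp y hf (mdifferentiableAt_extChartAt_symm hy)]
  rfl

/-- A vector field read in the chart at `x`. -/
noncomputable def chartField (I : ModelWithCorners ℝ E H)
    {M : Type*} [TopologicalSpace M] [ChartedSpace H M]
    (x : M) (V : Π y : M, TangentSpace I y) : E → E :=
  mpullback 𝓘(ℝ, E) I (extChartAt I x).symm V

theorem mfderiv_symm_chartField {x : M} {y : E} (hy : y ∈ (extChartAt I x).target)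
    (V : Π y : M, TangentSpace I y) :
    mfderiv 𝓘(ℝ, E) I (extChartAt I x).symm y ((chartField I x V : E → E) y) =
      V ((extChartAt I x).symm y) := by
  exact (isInvertible_mfderiv_extChartAt_symm hy).self_apply_inverse _

theorem differentiableAt_chartField [CompleteSpace E] {x : M} {V : Π y : M, TangentSpace I y}
    (hV : MDifferentiableAt I I.tangent (fun y => (⟨y, V y⟩ : TangentBundle I M)) x) :
    DifferentiableAt ℝ (chartField I x V) (extChartAt I x x) := by
  have : IsManifold I 2 M := IsManifold.of_le (n := ∞) (WithTop.coe_le_coe.2 le_top)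
  rw [← mdifferentiableWithinAt_univ] at hV
  have := hV.differentiableWithinAt_mpullbackWithin_vectorField
  simp only [I.range_eq_univ, Set.preimage_univ, Set.inter_self, mpullbackWithin_univ] at this
  exact differentiableWithinAt_univ.1 this

/-- `mlieBracket` transports the bracket in the chart by the inverse of the chart's differential;
without boundary this inverse is the differential of the inverse chart. -/
theorem mlieBracket_eq_chartField (x : M) (V W : Π y : M, TangentSpace I y) :
    mlieBracket I V W x = mfderiv 𝓘(ℝ, E) I (extChartAt I x).symm (extChartAt I x x)
      ((lieBracket ℝ (chartField I x V) (chartField I x W) : E → E) (extChartAt I x x)) := by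
  rw [← mlieBracketWithin_univ, mlieBracketWithin_apply]
  simp only [I.range_eq_univ, Set.preimage_univ, Set.inter_self, mpullbackWithin_univ]
  have h₁ := mfderivWithin_extChartAt_symm_comp_mfderiv_extChartAt' (I := I)
    (mem_extChartAt_source (I := I) x)
  rw [I.range_eq_univ, mfderivWithin_univ] at h₁
  have hi := isInvertible_mfderiv_extChartAt (I := I) (mem_extChartAt_source (I := I) x)
  obtain ⟨w, hw⟩ : ∃ w, mfderiv I 𝓘(ℝ, E) (extChartAt I x) x w =
      (lieBracket ℝ (chartField I x V) (chartField I x W) : E → E) (extChartAt I x x) :=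
    hi.bijective.2 _
  have h₂ := DFunLike.congr_fun h₁ w
  have h₃ : (mfderiv I 𝓘(ℝ, E) (extChartAt I x) x).inverse
      (mfderiv I 𝓘(ℝ, E) (extChartAt I x) x w) = w := hi.inverse_apply_self w
  have h₄ : lieBracketWithin ℝ (chartField I x V) (chartField I x W) Set.univ (extChartAt I x x) =
      mfderiv I 𝓘(ℝ, E) (extChartAt I x) x w := by
    rw [lieBracketWithin_univ]
    exact hw.symm
  exact (congrArg (mfderiv I 𝓘(ℝ, E) (extChartAt I x) x).inverse h₄).trans
    (h₃.trans (h₂.symm.trans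
      (congrArg (mfderiv 𝓘(ℝ, E) I (extChartAt I x).symm (extChartAt I x x)) hw)))

/-- The Lie bracket of vector fields is their commutator as derivations. -/
theorem mfderiv_mlieBracket [CompleteSpace E] {φ : M → G} {x : M}
    (hφ : ContMDiffAt I 𝓘(ℝ, G) ∞ φ x) {V W : Π y : M, TangentSpace I y}
    (hV : MDifferentiableAt I I.tangent (fun y => (⟨y, V y⟩ : TangentBundle I M)) x)
    (hW : MDifferentiableAt I I.tangent (fun y => (⟨y, W y⟩ : TangentBundle I M)) x)
    {a b : M → G} (ha : MDifferentiableAt I 𝓘(ℝ, G) a x) (hb : MDifferentiableAt I 𝓘(ℝ, G) b x)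
    (hVa : ∀ᶠ y in 𝓝 x, mvfderiv I φ y (V y) = a y)
    (hWb : ∀ᶠ y in 𝓝 x, mvfderiv I φ y (W y) = b y) :
    mvfderiv I φ x (mlieBracket I V W x) =
      mvfderiv I b x (V x) - mvfderiv I a x (W x) := by
  set e := extChartAt I x
  set y₀ := e x
  have hy₀ : y₀ ∈ e.target := mem_extChartAt_target x
  have hxe : e.symm y₀ = x := extChartAt_to_inv x
  set ψ : E → G := φ ∘ e.symm with hψ
  have hψs : ContDiffAt ℝ ∞ ψ y₀ := by
    rw [← contMDiffAt_iff_contDiffAt]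
    refine ContMDiffAt.comp y₀ ?_ (contMDiffAt_extChartAt_symm hy₀)
    rw [hxe]
    exact hφ
  have hsymm : IsSymmSndFDerivAt ℝ ψ y₀ := by
    refine hψs.isSymmSndFDerivAt ?_
    rw [minSmoothness_of_isRCLikeNormedField]
    exact WithTop.coe_le_coe.2 le_top
  have hψ' : DifferentiableAt ℝ (fderiv ℝ ψ) y₀ :=
    (hψs.fderiv_right (m := 1) (by norm_cast)).differentiableAt (by simp)
  have hφd : ∀ᶠ y in 𝓝 x, MDifferentiableAt I 𝓘(ℝ, G) φ y := by
    have : IsManifold I 1 M := IsManifold.of_le (n := ∞) (by norm_cast)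
    have h1 : ContMDiffAt I 𝓘(ℝ, G) 1 φ x := hφ.of_le (by norm_cast)
    exact ((contMDiffAt_iff_contMDiffAt_nhds (by simp)).1 h1).mono fun y hy =>
      hy.mdifferentiableAt (by simp)
  have hcont : Tendsto e.symm (𝓝 y₀) (𝓝 x) := by
    have := (contMDiffAt_extChartAt_symm (I := I) hy₀).continuousAt
    rwa [ContinuousAt, hxe] at this
  have key : ∀ (U : Π y : M, TangentSpace I y) (c : M → G),
      (∀ᶠ y in 𝓝 x, mvfderiv I φ y (U y) = c y) →
      (fun y => fderiv ℝ ψ y (chartField I x U y)) =ᶠ[𝓝 y₀] c ∘ e.symm := by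
    intro U c hc
    filter_upwards [hcont.eventually hc, hcont.eventually hφd,
      (isOpen_extChartAt_target x).mem_nhds hy₀] with y h₁ h₂ h₃
    rw [hψ, fderiv_comp_extChartAt_symm h₃ h₂, mfderiv_symm_chartField h₃]
    exact h₁
  -- In the chart, differentiating `c = Dψ(U)` along `U'` gives `D²ψ(U', U) + Dψ(DU · U')`. In the
  -- commutator the second-order terms cancel by symmetry, leaving `Dψ` of the bracket.
  have key' : ∀ (U U' : Π y : M, TangentSpace I y) (c : M → G),
      MDifferentiableAt I I.tangent (fun y => (⟨y, U y⟩ : TangentBundle I M)) x →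
      MDifferentiableAt I 𝓘(ℝ, G) c x →
      (∀ᶠ y in 𝓝 x, mvfderiv I φ y (U y) = c y) →
      mvfderiv I c x (U' x) =
        fderiv ℝ (fderiv ℝ ψ) y₀ (chartField I x U' y₀) (chartField I x U y₀) +
        fderiv ℝ ψ y₀ (fderiv ℝ (chartField I x U) y₀ (chartField I x U' y₀)) := by
    intro U U' c hU hc hcU
    have h₁ : fderiv ℝ (c ∘ e.symm) y₀ (chartField I x U' y₀) =
        mvfderiv I c (e.symm y₀) (U' (e.symm y₀)) := by
      rw [fderiv_comp_extChartAt_symm hy₀ (by rw [hxe]; exact hc), mfderiv_symm_chartField hy₀]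
    rw [hxe] at h₁
    rw [← (key U c hcU).fderiv_eq, fderiv_clm_apply hψ' (differentiableAt_chartField hU)] at h₁
    rw [← h₁]
    exact add_comm _ _
  rw [key' W V b hW hb hWb, key' V W a hV ha hVa, mlieBracket_eq_chartField]
  have h₂ := fderiv_comp_extChartAt_symm (I := I) (f := φ) hy₀
    (by rw [hxe]; exact hφ.mdifferentiableAt (by simp))
    (lieBracket ℝ (chartField I x V) (chartField I x W) y₀)
  have h₃ : mvfderiv I φ x (mfderiv 𝓘(ℝ, E) I e.symm y₀
      ((lieBracket ℝ (chartField I x V) (chartField I x W) : E → E) y₀)) =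
      fderiv ℝ ψ y₀ (lieBracket ℝ (chartField I x V) (chartField I x W) y₀) := by
    rw [h₂]
    congr 1
    rw [hxe]
  refine h₃.trans ?_
  rw [lieBracket_eq, map_sub, hsymm.eq]
  abel

end Commutator

end CompatTriples

namespace CompatTriples

open Filter Topology

/-! ### Trivialization coordinates for the anchor and the tensors; Hamiltonian sections. -/

section Coordinates

variable {M : Type*} [TopologicalSpace M]
  {F : Type*} [NormedAddCommGroup F] [NormedSpace ℝ F]
  {A : M → Type*} [TopologicalSpace (TotalSpace F A)]
  [∀ x, TopologicalSpace (A x)] [∀ x, AddCommGroup (A x)] [∀ x, Module ℝ (A x)]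
  [FiberBundle F A] [VectorBundle ℝ F A]

variable (F A) in
/-- The isomorphism of the model fibre with the fibre at `x`, in the trivialization around `p`. -/
noncomputable def frame (p x : M) : F →L[ℝ] A x := (trivializationAt F A p).symmL ℝ x

variable (F A) in
/-- The coordinates of a vector of the fibre at `x`, in the trivialization around `p`. -/
noncomputable def coframe (p x : M) : A x →L[ℝ] F :=
  (trivializationAt F A p).continuousLinearMapAt ℝ x

theorem frame_coframe {p x : M} (hx : x ∈ (trivializationAt F A p).baseSet) (a : A x) :
    frame F A p x (coframe F A p x a) = a :=
  (trivializationAt F A p).symmL_continuousLinearMapAt hx a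

theorem coframe_frame {p x : M} (hx : x ∈ (trivializationAt F A p).baseSet) (u : F) :
    coframe F A p x (frame F A p x u) = u :=
  (trivializationAt F A p).continuousLinearMapAt_symmL hx u

theorem trivializationAt_snd_eq_coframe {p x : M} (hx : x ∈ (trivializationAt F A p).baseSet)
    (a : A x) : (trivializationAt F A p ⟨x, a⟩).2 = coframe F A p x a :=
  (Trivialization.continuousLinearMapAt_apply_of_mem ℝ (trivializationAt F A p) hx a).symm

theorem inCoordinates_bilin_apply {x₀ x : M} (hx : x ∈ (trivializationAt F A x₀).baseSet)
    (B : A x →L[ℝ] A x →L[ℝ] ℝ) (u v : F) :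
    ContinuousLinearMap.inCoordinates F A (F →L[ℝ] ℝ) (fun x => A x →L[ℝ] ℝ) x₀ x x₀ x B u v =
      B (frame F A x₀ x u) (frame F A x₀ x v) := by
  rw [inCoordinates_apply_eq₂ (E₃ := fun _ : M => ℝ) (F₃ := ℝ) hx hx (by simp)]
  simp [frame, hx]

theorem exists_equiv_of_injective {F : Type*} [NormedAddCommGroup F] [NormedSpace ℝ F]
    [FiniteDimensional ℝ F] (B : F →L[ℝ] F →L[ℝ] ℝ) (h : ∀ u, (∀ v, B u v = 0) → u = 0) :
    ∃ e : F ≃L[ℝ] (F →L[ℝ] ℝ), (e : F →L[ℝ] F →L[ℝ] ℝ) = B := by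
  have hinj : Function.Injective (B : F →ₗ[ℝ] F →L[ℝ] ℝ) := by
    rw [← LinearMap.ker_eq_bot, LinearMap.ker_eq_bot']
    intro u hu
    exact h u fun v => by rw [show B u = 0 from hu]; simp
  have hd : Module.finrank ℝ F = Module.finrank ℝ (F →L[ℝ] ℝ) := by
    rw [(LinearMap.toContinuousLinearMap : (F →ₗ[ℝ] ℝ) ≃ₗ[ℝ] F →L[ℝ] ℝ).symm.finrank_eq]
    exact (Subspace.dual_finrank_eq).symm
  refine ⟨(LinearEquiv.ofInjectiveOfFinrankEq
    (B : F →ₗ[ℝ] F →L[ℝ] ℝ) hinj hd).toContinuousLinearEquiv, ?_⟩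
  ext u v
  rfl

end Coordinates

section Tangent

variable {E : Type*} [NormedAddCommGroup E] [NormedSpace ℝ E]
  {H : Type*} [TopologicalSpace H] {I : ModelWithCorners ℝ E H}
  {M : Type*} [TopologicalSpace M] [ChartedSpace H M] [IsManifold I ∞ M]

/-- This turns coordinates of tangent vectors into derivatives of the vector-valued function
`extChartAt I p`, to which the commutator formula applies. -/
theorem coframe_tangent {p x : M} (hx : x ∈ (chartAt H p).source) :
    coframe E (fun x : M => TangentSpace I x) p x = mvfderiv I (extChartAt I p) x := by
  have : IsManifold I 1 M := IsManifold.of_le (n := ∞) (by norm_cast)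
  exact TangentBundle.continuousLinearMapAt_trivializationAt hx

end Tangent

namespace CompatibleTriple

section Anchor

variable {E : Type*} [NormedAddCommGroup E] [NormedSpace ℝ E]
  {H : Type*} [TopologicalSpace H] {I : ModelWithCorners ℝ E H}
  {M : Type*} [TopologicalSpace M] [ChartedSpace H M] [IsManifold I ∞ M]
  {F : Type*} [NormedAddCommGroup F] [NormedSpace ℝ F]
  {A : M → Type*} [TopologicalSpace (TotalSpace F A)]
  [∀ x, TopologicalSpace (A x)] [∀ x, AddCommGroup (A x)] [∀ x, Module ℝ (A x)]
  [FiberBundle F A] [VectorBundle ℝ F A]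
  {𝒜 : LieAlgebroid I F A}

/-- The anchor in the coordinates around `p`. -/
noncomputable def anchorCoord (𝒜 : LieAlgebroid I F A) (p x : M) : F →L[ℝ] E :=
  ContinuousLinearMap.inCoordinates F A E (fun x : M => TangentSpace I x) p x p x (𝒜.anchor x)

theorem contMDiffAt_anchorCoord (p : M) :
    ContMDiffAt I 𝓘(ℝ, F →L[ℝ] E) ∞ (anchorCoord 𝒜 p) p :=
  ((contMDiffAt_hom_bundle _).1 (𝒜.contMDiff_anchor p)).2

theorem anchorCoord_apply {p x : M} (hx : x ∈ (chartAt H p).source) (u : F) :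
    anchorCoord 𝒜 p x u = mvfderiv I (extChartAt I p) x (𝒜.anchor x (frame F A p x u)) := by
  rw [← coframe_tangent hx]
  rfl

end Anchor

section Sections

variable {E : Type*} [NormedAddCommGroup E] [NormedSpace ℝ E]
  {H : Type*} [TopologicalSpace H] {I : ModelWithCorners ℝ E H}
  {M : Type*} [TopologicalSpace M] [ChartedSpace H M] [IsManifold I ∞ M]
  {F : Type*} [NormedAddCommGroup F] [NormedSpace ℝ F]
  {A : M → Type*} [TopologicalSpace (TotalSpace F A)]
  [∀ x, TopologicalSpace (A x)] [∀ x, AddCommGroup (A x)] [∀ x, Module ℝ (A x)]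
  [∀ x, IsTopologicalAddGroup (A x)] [∀ x, ContinuousSMul ℝ (A x)]
  [FiberBundle F A] [VectorBundle ℝ F A]
  {𝒜 : LieAlgebroid I F A} (T : CompatibleTriple 𝒜)

/-- The form in the coordinates around `p`. -/
noncomputable def formCoord (p x : M) : F →L[ℝ] F →L[ℝ] ℝ :=
  ContinuousLinearMap.inCoordinates F A (F →L[ℝ] ℝ) (fun x => A x →L[ℝ] ℝ) p x p x
    (T.form.toFun x)

/-- The metric in the coordinates around `p`. -/
noncomputable def gCoord (p x : M) : F →L[ℝ] F →L[ℝ] ℝ :=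
  ContinuousLinearMap.inCoordinates F A (F →L[ℝ] ℝ) (fun x => A x →L[ℝ] ℝ) p x p x
    (T.g.inner x)

/-- The complex structure in the coordinates around `p`. -/
noncomputable def JCoord (p x : M) : F →L[ℝ] F :=
  ContinuousLinearMap.inCoordinates F A F A p x p x (T.J.toFun x)

theorem contMDiffAt_formCoord (p : M) :
    ContMDiffAt I 𝓘(ℝ, F →L[ℝ] F →L[ℝ] ℝ) ∞ (T.formCoord p) p :=
  ((contMDiffAt_hom_bundle _).1 (T.form.contMDiff p)).2

theorem contMDiffAt_gCoord (p : M) :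
    ContMDiffAt I 𝓘(ℝ, F →L[ℝ] F →L[ℝ] ℝ) ∞ (T.gCoord p) p :=
  ((contMDiffAt_hom_bundle _).1 (T.g.contMDiff p)).2

theorem contMDiffAt_JCoord (p : M) :
    ContMDiffAt I 𝓘(ℝ, F →L[ℝ] F) ∞ (T.JCoord p) p :=
  ((contMDiffAt_hom_bundle _).1 (T.J.contMDiff p)).2

theorem formCoord_apply {p x : M} (hx : x ∈ (trivializationAt F A p).baseSet) (u v : F) :
    T.formCoord p x u v =
      T.form.toFun x (frame F A p x u) (frame F A p x v) :=
  inCoordinates_bilin_apply hx _ u v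

theorem gCoord_apply {p x : M} (hx : x ∈ (trivializationAt F A p).baseSet) (u v : F) :
    T.gCoord p x u v =
      T.g.inner x (frame F A p x u) (frame F A p x v) :=
  inCoordinates_bilin_apply hx _ u v

theorem JCoord_apply {p x : M} (hx : x ∈ (trivializationAt F A p).baseSet) (u : F) :
    frame F A p x (T.JCoord p x u) = T.J.toFun x (frame F A p x u) :=
  frame_coframe hx _

theorem formCoord_equiv [FiniteDimensional ℝ F] {p x : M}
    (hx : x ∈ (trivializationAt F A p).baseSet) :
    ∃ e : F ≃L[ℝ] (F →L[ℝ] ℝ), (e : F →L[ℝ] F →L[ℝ] ℝ) = T.formCoord p x := by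
  refine exists_equiv_of_injective _ fun u hu => ?_
  rw [← coframe_frame hx u]
  have h : frame F A p x u = 0 := by
    refine T.isSymplectic.nondegenerate x _ fun w => ?_
    rw [← frame_coframe hx w, ← T.formCoord_apply hx]
    exact hu _
  rw [h, map_zero]

theorem exists_form_eq [FiniteDimensional ℝ F] {p : M} (θ : A p →ₗ[ℝ] ℝ) :
    ∃ a : A p, ∀ b, T.form.toFun p a b = θ b := by
  have : FiniteDimensional ℝ (A p) := VectorBundle.finiteDimensional ℝ F A p
  set φ : A p →ₗ[ℝ] Module.Dual ℝ (A p) :=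
    LinearMap.mk₂ ℝ (fun v w => T.form.toFun p v w) (by simp) (by simp) (by simp) (by simp)
  have hinj : Function.Injective φ := by
    rw [← LinearMap.ker_eq_bot, LinearMap.ker_eq_bot']
    exact fun v hv => T.isSymplectic.nondegenerate p v fun w => LinearMap.congr_fun hv w
  obtain ⟨a, ha⟩ := (LinearMap.injective_iff_surjective_of_finrank_eq_finrank
    Subspace.dual_finrank_eq.symm).1 hinj θ
  exact ⟨a, fun b => LinearMap.congr_fun ha b⟩

/-- Every smooth function on the base has a smooth Hamiltonian section. -/
theorem exists_hamiltonian [FiniteDimensional ℝ F] (f : C^∞⟮I, M; 𝓘(ℝ, ℝ), ℝ⟯) :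
    ∃ s : Cₛ^∞⟮I; F, A⟯, ∀ x b, T.form.toFun x (s x) b = mvfderiv I f x (𝒜.anchor x b) := by
  have h : ∀ x, ∃ a : A x, ∀ b, T.form.toFun x a b = mvfderiv I f x (𝒜.anchor x b) := fun x =>
    T.exists_form_eq (((mvfderiv I f x).comp (𝒜.anchor x) : A x →L[ℝ] ℝ) : A x →ₗ[ℝ] ℝ)
  choose s hs using h
  have hsm : ∀ x₀, ContMDiffAt I (I.prod 𝓘(ℝ, F)) ∞ (fun x => TotalSpace.mk' F x (s x)) x₀ := by
    intro x₀
    rw [Bundle.contMDiffAt_section]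
    set e := trivializationAt F A x₀
    have hb := e.open_baseSet.mem_nhds (FiberBundle.mem_baseSet_trivializationAt F A x₀)
    have hdf := ContMDiffAt.mfderiv_const (m := ∞) (f.contMDiff x₀) (by simp)
    -- `θ` is `df ∘ ρ` in coordinates. The section is the inverse of the coordinate form applied to
    -- `θ`, and inversion of linear isomorphisms is smooth.
    set θ : M → F →L[ℝ] ℝ := fun x =>
      (inTangentCoordinates I 𝓘(ℝ, ℝ) id f (mfderiv I 𝓘(ℝ, ℝ) f) x₀ x) ∘L anchorCoord 𝒜 x₀ x
    have hθ : ContMDiffAt I 𝓘(ℝ, F →L[ℝ] ℝ) ∞ θ x₀ := hdf.clm_comp (contMDiffAt_anchorCoord x₀)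
    obtain ⟨e₀, he₀⟩ := T.formCoord_equiv (FiberBundle.mem_baseSet_trivializationAt F A x₀)
    have hinv : ContMDiffAt I 𝓘(ℝ, (F →L[ℝ] ℝ) →L[ℝ] F) ∞
        (fun x => (T.formCoord x₀ x).inverse) x₀ := by
      refine ContDiffAt.comp_contMDiffAt (g := fun L : F →L[ℝ] F →L[ℝ] ℝ => L.inverse) ?_
        (T.contMDiffAt_formCoord x₀)
      rw [← he₀]
      exact contDiffAt_map_inverse e₀
    refine (hinv.clm_apply hθ).congr_of_eventuallyEq ?_
    filter_upwards [hb, (chartAt H x₀).open_source.mem_nhds (mem_chart_source H x₀)] with x hx hx'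
    obtain ⟨e₁, he₁⟩ := T.formCoord_equiv hx
    rw [← he₁, ContinuousLinearMap.inverse_equiv]
    rw [ContinuousLinearEquiv.coe_coe, ContinuousLinearEquiv.eq_symm_apply,
      trivializationAt_snd_eq_coframe hx]
    ext v
    have e₂ : e₁ (coframe F A x₀ x (s x)) v = T.formCoord x₀ x (coframe F A x₀ x (s x)) v := by
      rw [← he₁]
      rfl
    have e₃ : θ x v = mvfderiv I f x (𝒜.anchor x (frame F A x₀ x v)) := by
      have e₄ := frame_coframe (A := fun x : M => TangentSpace I x) (F := E) (p := x₀) (x := x)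
        (by simpa using hx') (𝒜.anchor x (frame F A x₀ x v))
      have e₅ : ∀ y z : ℝ, coframe ℝ (fun x : ℝ => TangentSpace 𝓘(ℝ, ℝ) x) y z = (1 : ℝ →L[ℝ] ℝ) :=
        TangentBundle.continuousLinearMapAt_model_space
      have e₆ : θ x v = coframe ℝ (fun x : ℝ => TangentSpace 𝓘(ℝ, ℝ) x) (f x₀) (f x)
        (mfderiv I 𝓘(ℝ, ℝ) f x (frame E (fun x : M => TangentSpace I x) x₀ x
          (coframe E (fun x : M => TangentSpace I x) x₀ x
            (𝒜.anchor x (frame F A x₀ x v))))) := rfl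
      rw [e₆, e₄, e₅]
      rfl
    rw [e₂, T.formCoord_apply hx, frame_coframe hx, hs, e₃]
  exact ⟨⟨s, hsm⟩, hs⟩

end Sections

end CompatibleTriple

end CompatTriples

namespace CompatTriples

open Filter Topology VectorField

/-! ### Global functions and sections with prescribed germs. -/

section Cutoff

variable {E : Type*} [NormedAddCommGroup E] [NormedSpace ℝ E]
  {H : Type*} [TopologicalSpace H] {I : ModelWithCorners ℝ E H}
  {M : Type*} [TopologicalSpace M] [ChartedSpace H M] [IsManifold I ∞ M]
  {F : Type*} [NormedAddCommGroup F] [NormedSpace ℝ F]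
  {A : M → Type*} [TopologicalSpace (TotalSpace F A)]
  [∀ x, TopologicalSpace (A x)] [∀ x, AddCommGroup (A x)] [∀ x, Module ℝ (A x)]
  [FiberBundle F A] [VectorBundle ℝ F A]

/-- A bump function globalizes local coordinates, since Hamiltonian sections are built from global
functions. The next lemma does the same for frames, since the algebroid bracket accepts only global
sections. -/
theorem exists_smooth_eventually_eq [FiniteDimensional ℝ E] [T2Space M] (p : M) (ξ : E →L[ℝ] ℝ) :
    ∃ f : C^∞⟮I, M; 𝓘(ℝ, ℝ), ℝ⟯, ∀ᶠ x in 𝓝 p, f x = ξ (extChartAt I p x) := by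
  obtain ⟨χ⟩ : Nonempty (SmoothBumpFunction I p) := inferInstance
  have h : ContMDiffOn I 𝓘(ℝ, ℝ) ∞ (fun x => ξ (extChartAt I p x)) (chartAt H p).source :=
    ξ.contMDiff.comp_contMDiffOn contMDiffOn_extChartAt
  refine ⟨⟨fun x => χ x • ξ (extChartAt I p x), χ.contMDiff_smul h⟩, ?_⟩
  filter_upwards [χ.eventuallyEq_one] with x hx
  change χ x • ξ (extChartAt I p x) = _
  rw [hx, Pi.one_apply, one_smul]

theorem exists_frame_section [FiniteDimensional ℝ E] [T2Space M] [ContMDiffVectorBundle ∞ F A I]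
    (p : M) (v : F) :
    ∃ t : Cₛ^∞⟮I; F, A⟯, ∀ᶠ x in 𝓝 p, t x = frame F A p x v := by
  set e := trivializationAt F A p
  have hb := e.open_baseSet.mem_nhds (FiberBundle.mem_baseSet_trivializationAt F A p)
  obtain ⟨χ, -, hχ⟩ := (SmoothBumpFunction.nhds_basis_tsupport (I := I) p).mem_iff.1 hb
  have h : ContMDiffOn I (I.prod 𝓘(ℝ, F)) ∞ (fun x => TotalSpace.mk' F x (frame F A p x v))
      e.baseSet := by
    rw [e.contMDiffOn_section_baseSet_iff]
    refine (contMDiffOn_const (c := v)).congr fun x hx => ?_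
    rw [trivializationAt_snd_eq_coframe hx, coframe_frame hx]
  refine ⟨⟨_, ContMDiffOn.smul_section_of_tsupport χ.contMDiff.contMDiffOn e.open_baseSet hχ h⟩, ?_⟩
  filter_upwards [χ.eventuallyEq_one] with x hx
  change χ x • frame F A p x v = _
  rw [hx, Pi.one_apply, one_smul]

end Cutoff

section Derivative

variable {E : Type*} [NormedAddCommGroup E] [NormedSpace ℝ E]
  {H : Type*} [TopologicalSpace H] {I : ModelWithCorners ℝ E H}
  {M : Type*} [TopologicalSpace M] [ChartedSpace H M]
  {G : Type*} [NormedAddCommGroup G] [NormedSpace ℝ G]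
  {G' : Type*} [NormedAddCommGroup G'] [NormedSpace ℝ G']

theorem mvfderiv_clm_comp (L : G →L[ℝ] G') {f : M → G} {x : M}
    (hf : MDifferentiableAt I 𝓘(ℝ, G) f x) (v : TangentSpace I x) :
    mvfderiv I (fun y => L (f y)) x v = L (mvfderiv I f x v) := by
  have h := (L.hasMFDerivAt (x := f x)).comp x hf.hasMFDerivAt
  exact DFunLike.congr_fun h.mfderiv v

variable [IsManifold I ∞ M]

theorem ContMDiffAt.eventually_mdifferentiableAt {f : M → G} {x : M}
    (hf : ContMDiffAt I 𝓘(ℝ, G) ∞ f x) :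
    ∀ᶠ y in 𝓝 x, MDifferentiableAt I 𝓘(ℝ, G) f y := by
  have : IsManifold I 1 M := IsManifold.of_le (n := ∞) (by norm_cast)
  have h1 : ContMDiffAt I 𝓘(ℝ, G) 1 f x := hf.of_le (by norm_cast)
  exact ((contMDiffAt_iff_contMDiffAt_nhds (by simp)).1 h1).mono fun y hy =>
    hy.mdifferentiableAt (by simp)

theorem contMDiffAt_mvfderiv_frame {f : M → G} {x : M} (hf : ContMDiffAt I 𝓘(ℝ, G) ∞ f x) :
    ContMDiffAt I 𝓘(ℝ, E →L[ℝ] G) ∞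
      (fun y => mvfderiv I f y ∘L frame E (fun y : M => TangentSpace I y) x y) x := by
  have h := ContMDiffAt.mfderiv_const (m := ∞) hf (by simp)
  refine h.congr_of_eventuallyEq (Eventually.of_forall fun y => ?_)
  ext u
  have e₅ : ∀ y z : G, coframe G (fun x : G => TangentSpace 𝓘(ℝ, G) x) y z = (1 : G →L[ℝ] G) :=
    TangentBundle.continuousLinearMapAt_model_space
  have e₆ : inTangentCoordinates I 𝓘(ℝ, G) id f (mfderiv I 𝓘(ℝ, G) f) x y u =
      coframe G (fun x : G => TangentSpace 𝓘(ℝ, G) x) (f x) (f y)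
        (mfderiv I 𝓘(ℝ, G) f y (frame E (fun x : M => TangentSpace I x) x y u)) := rfl
  rw [e₆, e₅]
  rfl

end Derivative

/-! ### The derivative of the anchor along the anchor of a section. -/

section AnchorDerivative

variable {E : Type*} [NormedAddCommGroup E] [NormedSpace ℝ E]
  {H : Type*} [TopologicalSpace H] {I : ModelWithCorners ℝ E H}
  {M : Type*} [TopologicalSpace M] [ChartedSpace H M] [IsManifold I ∞ M]
  {F : Type*} [NormedAddCommGroup F] [NormedSpace ℝ F]
  {A : M → Type*} [TopologicalSpace (TotalSpace F A)]
  [∀ x, TopologicalSpace (A x)] [∀ x, AddCommGroup (A x)] [∀ x, Module ℝ (A x)]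
  [FiberBundle F A] [VectorBundle ℝ F A]
  {𝒜 : LieAlgebroid I F A}

theorem contMDiffAt_coframe (s : Cₛ^∞⟮I; F, A⟯) (p : M) :
    ContMDiffAt I 𝓘(ℝ, F) ∞ (fun x => coframe F A p x (s x)) p := by
  refine ((Bundle.contMDiffAt_section p).1 (s.contMDiff p)).congr_of_eventuallyEq ?_
  filter_upwards [(trivializationAt F A p).open_baseSet.mem_nhds
    (FiberBundle.mem_baseSet_trivializationAt F A p)] with x hx
  exact (trivializationAt_snd_eq_coframe hx _).symm

theorem mdifferentiableAt_anchor [∀ x, IsTopologicalAddGroup (A x)]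
    [∀ x, ContinuousSMul ℝ (A x)] (s : Cₛ^∞⟮I; F, A⟯) (x : M) :
    MDifferentiableAt I I.tangent (fun y => (⟨y, 𝒜.anchor y (s y)⟩ : TangentBundle I M)) x :=
  ((𝒜.contMDiff_anchor.clm_bundle_apply s.contMDiff) x).mdifferentiableAt (by simp)

variable [I.Boundaryless] [FiniteDimensional ℝ E] [T2Space M] [FiniteDimensional ℝ F]
  [ContMDiffVectorBundle ∞ F A I]

/-- The Lie derivative of the anchor along a section is expressed through the anchor. -/
theorem exists_mvfderiv_anchorCoord [∀ x, IsTopologicalAddGroup (A x)]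
    [∀ x, ContinuousSMul ℝ (A x)] (s : Cₛ^∞⟮I; F, A⟯) (p : M) :
    ∃ (B : M → E →L[ℝ] E) (C : M → F →L[ℝ] F), ContinuousAt B p ∧ ContinuousAt C p ∧
      ∀ᶠ x in 𝓝 p, mvfderiv I (CompatibleTriple.anchorCoord 𝒜 p) x (𝒜.anchor x (s x)) =
        B x ∘L CompatibleTriple.anchorCoord 𝒜 p x + CompatibleTriple.anchorCoord 𝒜 p x ∘L C x := by
  set R := CompatibleTriple.anchorCoord 𝒜 p with hR
  have hRs : ContMDiffAt I 𝓘(ℝ, F →L[ℝ] E) ∞ R p := CompatibleTriple.contMDiffAt_anchorCoord p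
  set X : M → E := fun x => R x (coframe F A p x (s x)) with hX
  have hXs : ContMDiffAt I 𝓘(ℝ, E) ∞ X p := hRs.clm_apply (contMDiffAt_coframe s p)
  set b := Module.finBasis ℝ F
  choose t ht using fun k => exists_frame_section (I := I) (A := A) p (b k)
  set β : Fin (Module.finrank ℝ F) → F →L[ℝ] ℝ := fun k =>
    LinearMap.toContinuousLinearMap (b.coord k)
  -- In coordinates `ρ[s, t_k] = [ρ s, ρ t_k]` reads `R [s, t_k] = dR(ρ s) b_k - dX(ρ t_k)`, with
  -- `X` the coordinates of `ρ s` and `t_k` the section extending `b_k`. So `B` is `dX`, and `C`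
  -- sends `b_k` to the coordinates of `[s, t_k]`.
  refine ⟨fun y => mvfderiv I X y ∘L frame E (fun y : M => TangentSpace I y) p y,
    fun x => ∑ k, (β k).smulRight (coframe F A p x (𝒜.bracket s (t k) x)),
    (contMDiffAt_mvfderiv_frame hXs).continuousAt, ?_, ?_⟩
  · refine tendsto_finsetSum _ fun k _ => ?_
    have h := (contMDiffAt_coframe (𝒜.bracket s (t k)) p).continuousAt
    exact ((ContinuousLinearMap.smulRightL ℝ F F (β k)).continuous.continuousAt).comp h
  · have hbase := (trivializationAt F A p).open_baseSet.mem_nhds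
      (FiberBundle.mem_baseSet_trivializationAt F A p)
    have hsrc := (chartAt H p).open_source.mem_nhds (mem_chart_source H p)
    have hXeq : ∀ᶠ x in 𝓝 p, mvfderiv I (extChartAt I p) x (𝒜.anchor x (s x)) = X x := by
      filter_upwards [hbase, hsrc] with x hx hx'
      rw [hX, hR]
      change _ = CompatibleTriple.anchorCoord 𝒜 p x _
      rw [CompatibleTriple.anchorCoord_apply hx', frame_coframe hx]
    have hReq : ∀ k, ∀ᶠ x in 𝓝 p,
        mvfderiv I (extChartAt I p) x (𝒜.anchor x (t k x)) = R x (b k) := by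
      intro k
      filter_upwards [hsrc, ht k] with x hx' hx
      rw [hR, CompatibleTriple.anchorCoord_apply hx', hx]
    filter_upwards [hbase, hsrc, hXeq.eventually_nhds,
      (eventually_all.2 hReq).eventually_nhds, eventually_all.2 ht,
      ContMDiffAt.eventually_mdifferentiableAt hRs,
      ContMDiffAt.eventually_mdifferentiableAt hXs] with x hx hx' hXx hRx htx hRd hXd
    refine ContinuousLinearMap.coe_injective (b.ext fun k => ?_)
    have hbd : MDifferentiableAt I 𝓘(ℝ, E) (fun y => R y (b k)) x :=
      hRd.clm_apply mdifferentiableAt_const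
    have key := mfderiv_mlieBracket (I := I) (φ := extChartAt I p) (x := x)
      (contMDiffAt_extChartAt' hx') (mdifferentiableAt_anchor s x)
      (mdifferentiableAt_anchor (t k) x) hXd hbd hXx (hRx.mono fun y hy => hy k)
    rw [← 𝒜.anchor_bracket] at key
    have e₁ : mvfderiv I (fun y => R y (b k)) x (𝒜.anchor x (s x)) =
        mvfderiv I R x (𝒜.anchor x (s x)) (b k) :=
      mvfderiv_clm_comp (ContinuousLinearMap.apply ℝ E (b k)) hRd _
    have e₂ : mvfderiv I (extChartAt I p) x (𝒜.anchor x (𝒜.bracket s (t k) x)) =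
        R x (coframe F A p x (𝒜.bracket s (t k) x)) := by
      rw [hR, CompatibleTriple.anchorCoord_apply hx', frame_coframe hx]
    have e₃ : frame E (fun y : M => TangentSpace I y) p x (R x (b k)) = 𝒜.anchor x (t k x) := by
      rw [hRx.self_of_nhds k |>.symm, ← coframe_tangent hx', frame_coframe (by simpa using hx')]
    have e₄ : (∑ j, (β j).smulRight (coframe F A p x (𝒜.bracket s (t j) x))) (b k) =
        coframe F A p x (𝒜.bracket s (t k) x) := by
      rw [sum_apply, Finset.sum_eq_single k]
      · simp [β]
      · intro j _ hj
        simp [β, Finsupp.single_eq_of_ne hj]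
      · simp
    rw [e₁, e₂] at key
    change mvfderiv I R x (𝒜.anchor x (s x)) (b k) =
      mvfderiv I X x (frame E (fun y : M => TangentSpace I y) p x (R x (b k))) +
        R x ((∑ j, (β j).smulRight (coframe F A p x (𝒜.bracket s (t j) x))) (b k))
    rw [e₃, e₄, key]
    abel

end AnchorDerivative

end CompatTriples

namespace CompatTriples

open Filter Topology

theorem norm_sum_smul_le {n : ℕ} {G : Type*} [NormedAddCommGroup G] [NormedSpace ℝ G]
    (c : Fin n → ℝ) {Z : Fin n → G} {κ : Fin n → ℝ} (hZ : ∀ i, ‖Z i‖ ≤ κ i) :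
    ‖∑ i, c i • Z i‖ ≤ (∑ i, κ i) * ‖c‖ := by
  rw [mul_comm, Finset.mul_sum]
  refine norm_sum_le_of_le _ fun i _ => ?_
  rw [norm_smul]
  exact mul_le_mul (norm_le_pi_norm c i) (hZ i) (norm_nonneg _) (norm_nonneg _)

section Tangent

variable {E : Type*} [NormedAddCommGroup E] [NormedSpace ℝ E]
  {H : Type*} [TopologicalSpace H] {I : ModelWithCorners ℝ E H}
  {M : Type*} [TopologicalSpace M] [ChartedSpace H M] [IsManifold I ∞ M]

theorem mvfderiv_extChartAt_injective {p x : M} (hx : x ∈ (chartAt H p).source) :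
    Function.Injective (mvfderiv I (extChartAt I p) x) := by
  rw [← coframe_tangent hx]
  exact Function.LeftInverse.injective (g := frame E (fun x : M => TangentSpace I x) p x)
    (frame_coframe (by simpa using hx))

variable
  {E' : Type*} [NormedAddCommGroup E'] [NormedSpace ℝ E']
  {H' : Type*} [TopologicalSpace H'] {I' : ModelWithCorners ℝ E' H'}
  {O : Type*} [TopologicalSpace O] [ChartedSpace H' O] [IsManifold I' ∞ O]
  {ι : O → M}

variable (I I' ι) in
noncomputable def mfderivCoord (q₀ q : O) : E' →L[ℝ] E :=
  mvfderiv I' (fun q => extChartAt I (ι q₀) (ι q)) q ∘L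
    frame E' (fun q : O => TangentSpace I' q) q₀ q

theorem contMDiffAt_mfderivCoord (hι : ContMDiff I' I ∞ ι) (q₀ : O) :
    ContMDiffAt I' 𝓘(ℝ, E' →L[ℝ] E) ∞ (mfderivCoord I I' ι q₀) q₀ :=
  contMDiffAt_mvfderiv_frame (f := fun q => extChartAt I (ι q₀) (ι q))
    (ContMDiffAt.comp q₀ (contMDiffAt_extChartAt' (mem_chart_source H (ι q₀))) (hι q₀))

theorem mfderivCoord_apply (hι : ContMDiff I' I ∞ ι) {q₀ q : O}
    (hq : ι q ∈ (chartAt H (ι q₀)).source) (u : E') :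
    mfderivCoord I I' ι q₀ q u = mvfderiv I (extChartAt I (ι q₀)) (ι q)
      (mfderiv I' I ι q (frame E' (fun q : O => TangentSpace I' q) q₀ q u)) := by
  have hφ : MDifferentiableAt I 𝓘(ℝ, E) (extChartAt I (ι q₀)) (ι q) :=
    (contMDiffAt_extChartAt' hq).mdifferentiableAt (n := ∞) (by simp)
  exact mfderiv_comp_apply q hφ (hι.mdifferentiable (by simp) q) _

theorem mfderivCoord_injective {Λ : ∀ p : M, Submodule ℝ (TangentSpace I p)}
    (hι : IsIntegralSubmanifold I' Λ ι) (q₀ : O) :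
    Function.Injective (mfderivCoord I I' ι q₀ q₀) := by
  intro u v huv
  rw [mfderivCoord_apply hι.contMDiff (mem_chart_source H _),
    mfderivCoord_apply hι.contMDiff (mem_chart_source H _)] at huv
  have h := hι.injective_mfderiv q₀ (mvfderiv_extChartAt_injective (mem_chart_source H _) huv)
  rw [← coframe_frame (A := fun q : O => TangentSpace I' q) (F := E') (p := q₀) (x := q₀)
    (by simp) u, h, coframe_frame (by simp)]

end Tangent

namespace CompatibleTriple

/-! ### Hamiltonian sections spanning `L^ω`. -/

section Span

variable {E : Type*} [NormedAddCommGroup E] [NormedSpace ℝ E]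
  {H : Type*} [TopologicalSpace H] {I : ModelWithCorners ℝ E H}
  {M : Type*} [TopologicalSpace M] [ChartedSpace H M] [IsManifold I ∞ M]
  {F : Type*} [NormedAddCommGroup F] [NormedSpace ℝ F]
  {A : M → Type*} [TopologicalSpace (TotalSpace F A)]
  [∀ x, TopologicalSpace (A x)] [∀ x, AddCommGroup (A x)] [∀ x, Module ℝ (A x)]
  [∀ x, IsTopologicalAddGroup (A x)] [∀ x, ContinuousSMul ℝ (A x)]
  [FiberBundle F A] [VectorBundle ℝ F A]
  {𝒜 : LieAlgebroid I F A}
  [FiniteDimensional ℝ E] [T2Space M] [FiniteDimensional ℝ F]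

/-- Around every point there are global sections of `L^ω` spanning it. -/
theorem exists_sections_span_orth_L (T : CompatibleTriple 𝒜) (p : M) :
    ∃ (n : ℕ) (s : Fin n → Cₛ^∞⟮I; F, A⟯),
      (∀ i x, s i x ∈ orth (T.form.toFun x) (T.L x)) ∧
      ∀ᶠ x in 𝓝 p, ∀ a ∈ orth (T.form.toFun x) (T.L x), ∃ c : Fin n → ℝ,
        a = ∑ i, c i • s i x := by
  set b := Module.finBasis ℝ E
  choose f hf using fun i => exists_smooth_eventually_eq (I := I) p
    (LinearMap.toContinuousLinearMap (b.coord i))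
  choose s hs using fun i => T.exists_hamiltonian (f i)
  refine ⟨_, s, fun i x l hl => ?_, ?_⟩
  · rw [hs, T.mem_L.1 hl, map_zero]
  · filter_upwards [(eventually_all.2 hf).eventually_nhds,
      (chartAt H p).open_source.mem_nhds (mem_chart_source H p)] with x hx hx' a ha
    obtain ⟨ξ, hξ⟩ := T.exists_covector ha
    have hd : ∀ i v, mvfderiv I (f i) x v =
        b.coord i (coframe E (fun x : M => TangentSpace I x) p x v) := by
      intro i v
      have h : (f i : M → ℝ) =ᶠ[𝓝 x] fun y =>
          LinearMap.toContinuousLinearMap (b.coord i) (extChartAt I p y) :=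
        hx.mono fun y hy => hy i
      rw [mvfderiv, h.mfderiv_eq]
      refine (mvfderiv_clm_comp _ ?_ v).trans ?_
      · exact (contMDiffAt_extChartAt' hx').mdifferentiableAt (n := ∞) (by simp)
      · rw [← coframe_tangent hx']
        rfl
    -- An element of `L^ω` is `ω`-dual to some `ξ ∘ ρ`. Expanding `ξ` in the coordinate
    -- differentials, which are the `df_i` near `p`, gives the coefficients; nondegeneracy of `ω`
    -- gives the equality.
    refine ⟨fun i => ξ (frame E (fun x : M => TangentSpace I x) p x (b i)), ?_⟩
    rw [← sub_eq_zero]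
    refine T.isSymplectic.nondegenerate x _ fun w => ?_
    simp only [map_sub, map_sum, map_smul, sub_apply, sum_apply, smul_apply, hs, hξ, hd,
      smul_eq_mul]
    set v := 𝒜.anchor x w
    have hv : v = ∑ i, b.coord i (coframe E (fun x : M => TangentSpace I x) p x v) •
        frame E (fun x : M => TangentSpace I x) p x (b i) := by
      have h := frame_coframe (A := fun x : M => TangentSpace I x) (F := E) (p := p)
        (x := x) (by simpa using hx') v
      rw [← b.sum_repr (coframe E (fun x : M => TangentSpace I x) p x v), map_sum] at h
      simp only [map_smul] at h
      exact h.symm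
    have hξv := congrArg ξ hv
    simp only [map_sum, map_smul, smul_eq_mul] at hξv
    rw [hξv, sub_eq_zero]
    exact Finset.sum_congr rfl fun i _ => mul_comm _ _

end Span

/-! ### Constancy of the rank of the anchor along integral submanifolds. -/

section Rank

variable {E : Type*} [NormedAddCommGroup E] [NormedSpace ℝ E]
  {H : Type*} [TopologicalSpace H] {I : ModelWithCorners ℝ E H}
  {M : Type*} [TopologicalSpace M] [ChartedSpace H M] [IsManifold I ∞ M]
  {F : Type*} [NormedAddCommGroup F] [NormedSpace ℝ F]
  {A : M → Type*} [TopologicalSpace (TotalSpace F A)]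
  [∀ x, TopologicalSpace (A x)] [∀ x, AddCommGroup (A x)] [∀ x, Module ℝ (A x)]
  [∀ x, IsTopologicalAddGroup (A x)] [∀ x, ContinuousSMul ℝ (A x)]
  [FiberBundle F A] [VectorBundle ℝ F A]
  {𝒜 : LieAlgebroid I F A} [I.Boundaryless]
  [FiniteDimensional ℝ E] [T2Space M] [FiniteDimensional ℝ F] [ContMDiffVectorBundle ∞ F A I]
  {E' : Type*} [NormedAddCommGroup E'] [NormedSpace ℝ E'] [FiniteDimensional ℝ E']
  {H' : Type*} [TopologicalSpace H'] {I' : ModelWithCorners ℝ E' H'} [I'.Boundaryless]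
  {O : Type*} [TopologicalSpace O] [ChartedSpace H' O] [IsManifold I' ∞ O]
  {ι : O → M}

/-- The anchor has locally constant rank along an integral submanifold. -/
theorem eventually_anchorCoord_comp_outer_inverse (T : CompatibleTriple 𝒜)
    (hι : IsIntegralSubmanifold I' T.Λ ι) (q₀ : O) {W : (F →L[ℝ] E) → (E →L[ℝ] F)}
    (hW₀ : anchorCoord 𝒜 (ι q₀) (ι q₀) ∘L W (anchorCoord 𝒜 (ι q₀) (ι q₀)) ∘L
      anchorCoord 𝒜 (ι q₀) (ι q₀) = anchorCoord 𝒜 (ι q₀) (ι q₀))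
    (hWc : ContinuousAt W (anchorCoord 𝒜 (ι q₀) (ι q₀)))
    (hW : ∀ᶠ R in 𝓝 (anchorCoord 𝒜 (ι q₀) (ι q₀)), W R ∘L R ∘L W R = W R ∧
      ∃ W' : (F →L[ℝ] E) →L[ℝ] (E →L[ℝ] F), HasFDerivAt W W' R ∧
        ∀ X, W' X = -(W R ∘L X ∘L W R)) :
    ∀ᶠ q in 𝓝 q₀, anchorCoord 𝒜 (ι q₀) (ι q) ∘L W (anchorCoord 𝒜 (ι q₀) (ι q)) ∘L
      anchorCoord 𝒜 (ι q₀) (ι q) = anchorCoord 𝒜 (ι q₀) (ι q) := by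
  set p := ι q₀ with hp
  obtain ⟨n, s, hsL, hspan⟩ := T.exists_sections_span_orth_L p
  set R : O → F →L[ℝ] E := fun q => anchorCoord 𝒜 p (ι q) with hR
  have hιc : Tendsto ι (𝓝 q₀) (𝓝 p) := hι.contMDiff.continuous.continuousAt
  have hRs : ContMDiffAt I' 𝓘(ℝ, F →L[ℝ] E) ∞ R q₀ :=
    (contMDiffAt_anchorCoord p).comp q₀ (hι.contMDiff q₀)
  set D := mfderivCoord I I' ι q₀ with hD
  set Y : O → (Fin n → ℝ) →L[ℝ] E := fun q => ∑ i,
    (ContinuousLinearMap.proj (R := ℝ) (φ := fun _ : Fin n => ℝ) i).smulRight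
      (R q (coframe F A p (ι q) (s i (ι q)))) with hY
  have hbase := hιc ((trivializationAt F A p).open_baseSet.mem_nhds
      (FiberBundle.mem_baseSet_trivializationAt F A p))
  have hsrc := hιc ((chartAt H p).open_source.mem_nhds (mem_chart_source H p))
  have hsrc' := (chartAt H' q₀).open_source.mem_nhds (mem_chart_source H' q₀)
  have hYapp : ∀ᶠ q in 𝓝 q₀, ∀ c, Y q c = mvfderiv I (extChartAt I p) (ι q)
      (𝒜.anchor (ι q) (∑ i, c i • s i (ι q))) := by
    filter_upwards [hbase, hsrc] with q hq hq' c
    simp only [hY, sum_apply, map_sum, map_smul]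
    refine Finset.sum_congr rfl fun i _ => ?_
    change c i • R q _ = _
    rw [hR]
    change c i • anchorCoord 𝒜 p (ι q) _ = _
    rw [anchorCoord_apply hq', frame_coframe hq]
  have hYc : ContinuousAt Y q₀ := by
    refine tendsto_finsetSum _ fun i _ => ?_
    have h := hRs.continuousAt.clm_apply
      (ContinuousAt.comp (f := ι) (contMDiffAt_coframe (s i) p).continuousAt hιc)
    exact ((ContinuousLinearMap.smulRightL ℝ (Fin n → ℝ) E
      (ContinuousLinearMap.proj i)).continuous.continuousAt).comp h
  have hframe : ∀ {q : O}, q ∈ (chartAt H' q₀).source → ∀ X : TangentSpace I' q,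
      frame E' (fun q : O => TangentSpace I' q) q₀ q
        (coframe E' (fun q : O => TangentSpace I' q) q₀ q X) = X := fun hq X =>
    frame_coframe (by simpa using hq) X
  -- Both ranges are `Λ` in coordinates: that of `D` because `O` is integral, that of `Y` because
  -- the `s i` span `L^ω`.
  have hr : ∀ᶠ q in 𝓝 q₀, ∀ v, (∃ u, D q u = v) ↔ ∃ c, Y q c = v := by
    filter_upwards [hsrc, hsrc', hYapp, hιc.eventually hspan] with q hq hq' hYq hsq v
    constructor
    · rintro ⟨u, rfl⟩
      have h : mfderiv I' I ι q (frame E' (fun q : O => TangentSpace I' q) q₀ q u) ∈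
          T.Λ (ι q) := by
        rw [← hι.range_mfderiv q]
        exact ⟨_, rfl⟩
      obtain ⟨a, ha, haρ⟩ := T.mem_Λ.1 h
      obtain ⟨c, rfl⟩ := hsq a ha
      refine ⟨c, ?_⟩
      rw [hYq, hD, mfderivCoord_apply hι.contMDiff hq, ← haρ]
    · rintro ⟨c, rfl⟩
      have h : 𝒜.anchor (ι q) (∑ i, c i • s i (ι q)) ∈ T.Λ (ι q) :=
        T.mem_Λ.2 ⟨_, Submodule.sum_mem _ fun i _ => Submodule.smul_mem _ _ (hsL i _), rfl⟩
      rw [← hι.range_mfderiv q] at h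
      obtain ⟨X, hX⟩ := h
      refine ⟨coframe E' (fun q : O => TangentSpace I' q) q₀ q X, ?_⟩
      rw [hYq, hD, mfderivCoord_apply hι.contMDiff hq, hframe hq', ← hX]
      rfl
  -- Each tangent vector of `O` is a combination of the `ρ(s i)` whose coefficients are bounded
  -- uniformly in the point; this uniformity is what Grönwall's lemma needs, and continuity of the
  -- coefficients is not required.
  obtain ⟨K, hK⟩ := eventually_exists_bounded_preimage
    (contMDiffAt_mfderivCoord hι.contMDiff q₀).continuousAt hYc (mfderivCoord_injective hι q₀) hr
  choose B C hB hC hBC using fun i => exists_mvfderiv_anchorCoord (𝒜 := 𝒜) (s i) p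
  have hBb : ∀ i, ∀ᶠ x in 𝓝 p, ‖B i x‖ < ‖B i p‖ + 1 := fun i =>
    (hB i).norm.eventually_lt continuousAt_const (lt_add_one _)
  have hCb : ∀ i, ∀ᶠ x in 𝓝 p, ‖C i x‖ < ‖C i p‖ + 1 := fun i =>
    (hC i).norm.eventually_lt continuousAt_const (lt_add_one _)
  -- Each summand dominates both `‖B i‖` and `‖C i‖` near `p`, so one constant serves for the two
  -- combinations.
  set κ := ∑ i, (‖B i p‖ + ‖C i p‖ + 1) with hκ
  have hκ0 : 0 ≤ κ := Finset.sum_nonneg fun i _ => by positivity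
  have hRd := ContMDiffAt.eventually_mdifferentiableAt (contMDiffAt_anchorCoord (𝒜 := 𝒜) p)
  have hmain : ∀ᶠ q in 𝓝 q₀, ∀ u, ∃ (B : E →L[ℝ] E) (C : F →L[ℝ] F),
      ‖B‖ ≤ κ * K * ‖u‖ ∧ ‖C‖ ≤ κ * K * ‖u‖ ∧
      mvfderiv I' R q (frame E' (fun q : O => TangentSpace I' q) q₀ q u) =
        B ∘L R q + R q ∘L C := by
    filter_upwards [hsrc, hYapp, hK, hιc.eventually (eventually_all.2 hBC),
      hιc.eventually (eventually_all.2 hBb), hιc.eventually (eventually_all.2 hCb),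
      hιc.eventually hRd] with q hq hYq hKq hBCq hBq hCq hRq u
    obtain ⟨c, hc, hcn⟩ := hKq u
    have hcκ : κ * ‖c‖ ≤ κ * K * ‖u‖ := by
      rw [mul_assoc]
      exact mul_le_mul_of_nonneg_left hcn hκ0
    refine ⟨∑ i, c i • B i (ι q), ∑ i, c i • C i (ι q), (norm_sum_smul_le c fun i => ?_).trans hcκ,
      (norm_sum_smul_le c fun i => ?_).trans hcκ, ?_⟩
    · linarith [hBq i, norm_nonneg (C i p)]
    · linarith [hCq i, norm_nonneg (B i p)]
    · have hιu : mfderiv I' I ι q (frame E' (fun q : O => TangentSpace I' q) q₀ q u) =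
          𝒜.anchor (ι q) (∑ i, c i • s i (ι q)) := by
        apply mvfderiv_extChartAt_injective hq
        rw [← hYq, hc, mfderivCoord_apply hι.contMDiff hq]
      have h := mfderiv_comp_apply q hRq (hι.contMDiff.mdifferentiable (by simp) q)
        (frame E' (fun q : O => TangentSpace I' q) q₀ q u)
      rw [hιu] at h
      refine h.trans ?_
      change mvfderiv I (anchorCoord 𝒜 p) (ι q) (𝒜.anchor (ι q) (∑ i, c i • s i (ι q))) = _
      rw [map_sum, map_sum]
      have hi : ∀ i, mvfderiv I (anchorCoord 𝒜 p) (ι q) (𝒜.anchor (ι q) (c i • s i (ι q))) =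
          c i • (B i (ι q) ∘L anchorCoord 𝒜 p (ι q) + anchorCoord 𝒜 p (ι q) ∘L C i (ι q)) := by
        intro i
        rw [map_smul, map_smul, hBCq]
      simp only [hi]
      ext w
      simp only [sum_apply, smul_apply, add_apply, ContinuousLinearMap.comp_apply, smul_add,
        Finset.sum_add_distrib, map_sum, map_smul]
      rfl
  -- The differential inequality is integrated along segments, so the family is transported to the
  -- model space of `O`.
  set ψ := extChartAt I' q₀ with hψ
  have hψt : Tendsto ψ.symm (𝓝 (ψ q₀)) (𝓝 q₀) := by
    have := continuousAt_extChartAt_symm (I := I') q₀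
    rwa [ContinuousAt, extChartAt_to_inv] at this
  have hψq : ψ.symm (ψ q₀) = q₀ := extChartAt_to_inv q₀
  have hRd' := ContMDiffAt.eventually_mdifferentiableAt hRs
  have htgt := extChartAt_target_mem_nhds (I := I') q₀
  have hfinal : ∀ᶠ y in 𝓝 (ψ q₀), (R ∘ ψ.symm) y ∘L W ((R ∘ ψ.symm) y) ∘L (R ∘ ψ.symm) y =
      (R ∘ ψ.symm) y := by
    have h₀ : (R ∘ ψ.symm) (ψ q₀) = R q₀ := congrArg R hψq
    refine eventually_comp_outer_inverse (K := κ * K) ?_ ?_ ?_ (by rw [h₀]; exact hW₀)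
      (by rw [h₀]; exact hWc) (by rw [h₀]; exact hW)
    · refine ContinuousAt.comp ?_ (continuousAt_extChartAt_symm (I := I') q₀)
      rw [hψq]
      exact hRs.continuousAt
    · filter_upwards [htgt, hψt.eventually hRd'] with y hy hRy
      exact mdifferentiableAt_iff_differentiableAt.1
        (hRy.comp y (mdifferentiableAt_extChartAt_symm hy))
    · filter_upwards [htgt, eventually_eventually_nhds.2 htgt, hψt.eventually hRd',
        hψt.eventually hmain, hψt.eventually hsrc'] with y hy hy' hRy hmy hys u
      obtain ⟨B, C, hBn, hCn, h⟩ := hmy u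
      refine ⟨B, C, hBn, hCn, ?_⟩
      rw [fderiv_comp_extChartAt_symm hy hRy]
      -- The tangent frame around `q₀` is the coordinate frame of the chart: the two vectors have
      -- the same coordinates, the chart following its inverse being the identity.
      have hu : mfderiv 𝓘(ℝ, E') I' (extChartAt I' q₀).symm y u =
          frame E' (fun q : O => TangentSpace I' q) q₀ (ψ.symm y) u := by
        rw [← hframe hys (mfderiv 𝓘(ℝ, E') I' (extChartAt I' q₀).symm y u)]
        congr 1
        rw [coframe_tangent hys, ← fderiv_comp_extChartAt_symm hy
          ((contMDiffAt_extChartAt' hys).mdifferentiableAt (n := ∞) (by simp))]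
        have hid : (extChartAt I' q₀ : O → E') ∘ (extChartAt I' q₀).symm =ᶠ[𝓝 y] id :=
          hy'.mono fun z hz => (extChartAt I' q₀).right_inv hz
        rw [hid.fderiv_eq, fderiv_id]
        rfl
      rw [hu]
      exact h
  have hψc : Tendsto ψ (𝓝 q₀) (𝓝 (ψ q₀)) := continuousAt_extChartAt q₀
  filter_upwards [hψc.eventually hfinal, extChartAt_source_mem_nhds (I := I') q₀] with q hq hqs
  have : ψ.symm (ψ q) = q := ψ.left_inv hqs
  simp only [Function.comp_apply, this] at hq
  exact hq

end Rank

end CompatibleTriple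

end CompatTriples

namespace CompatTriples

open Filter Topology

/-! ### Smoothness of the lift to `E²`. -/

section Bilinear

variable {E : Type*} [NormedAddCommGroup E] [NormedSpace ℝ E]
  {H : Type*} [TopologicalSpace H] {I : ModelWithCorners ℝ E H}
  {M : Type*} [TopologicalSpace M] [ChartedSpace H M]
  {F : Type*} [NormedAddCommGroup F] [NormedSpace ℝ F]
  {G₁ : Type*} [NormedAddCommGroup G₁] [NormedSpace ℝ G₁]
  {G₂ : Type*} [NormedAddCommGroup G₂] [NormedSpace ℝ G₂]

set_option synthInstance.maxHeartbeats 200000 in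
theorem contMDiffAt_bilinearComp {B : M → F →L[ℝ] F →L[ℝ] ℝ} {S : M → G₁ →L[ℝ] F}
    {S' : M → G₂ →L[ℝ] F} {x : M} (hB : ContMDiffAt I 𝓘(ℝ, F →L[ℝ] F →L[ℝ] ℝ) ∞ B x)
    (hS : ContMDiffAt I 𝓘(ℝ, G₁ →L[ℝ] F) ∞ S x) (hS' : ContMDiffAt I 𝓘(ℝ, G₂ →L[ℝ] F) ∞ S' x) :
    ContMDiffAt I 𝓘(ℝ, G₁ →L[ℝ] G₂ →L[ℝ] ℝ) ∞ (fun y => (B y).bilinearComp (S y) (S' y)) x := by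
  have hL : ContDiff ℝ ∞ fun L : G₂ →L[ℝ] F => (ContinuousLinearMap.compL ℝ G₂ F ℝ).flip L :=
    ContinuousLinearMap.contDiff _
  have h := hL.contDiffAt.comp_contMDiffAt hS'
  exact h.clm_comp (hB.clm_comp hS)

/-- For `P` a left inverse of `D x`, the maps `P D y` are invertible near `x`, and `(P D y)⁻¹ P`
works. It recovers tangent vectors of `O` smoothly from their images in `TM`. -/
theorem exists_contMDiffAt_left_inverse [FiniteDimensional ℝ F] [FiniteDimensional ℝ G₁]
    {D : M → G₁ →L[ℝ] F} {x : M}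
    (hD : ContMDiffAt I 𝓘(ℝ, G₁ →L[ℝ] F) ∞ D x) (hinj : Function.Injective (D x)) :
    ∃ L : M → F →L[ℝ] G₁, ContMDiffAt I 𝓘(ℝ, F →L[ℝ] G₁) ∞ L x ∧
      ∀ᶠ y in 𝓝 x, ∀ u, L y (D y u) = u := by
  obtain ⟨P, hP⟩ := (D x : G₁ →ₗ[ℝ] F).exists_leftInverse_of_injective
    (LinearMap.ker_eq_bot.2 hinj)
  set P' : F →L[ℝ] G₁ := LinearMap.toContinuousLinearMap P
  have hN : ContMDiffAt I 𝓘(ℝ, G₁ →L[ℝ] G₁) ∞ (fun y => P' ∘L D y) x :=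
    contMDiffAt_const.clm_comp hD
  have h₀ : P' ∘L D x = (ContinuousLinearEquiv.refl ℝ G₁ : G₁ →L[ℝ] G₁) := by
    ext u
    exact LinearMap.congr_fun hP u
  have hcomp : CompleteSpace G₁ := FiniteDimensional.complete ℝ G₁
  refine ⟨fun y => (P' ∘L D y).inverse ∘L P', ?_, ?_⟩
  · refine ContMDiffAt.clm_comp ?_ contMDiffAt_const
    refine ContDiffAt.comp_contMDiffAt (g := fun L : G₁ →L[ℝ] G₁ => L.inverse) ?_ hN
    rw [h₀]
    exact contDiffAt_map_inverse _
  · have := (ContinuousLinearEquiv.refl ℝ G₁).nhds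
    rw [← h₀] at this
    filter_upwards [hN.continuousAt this] with y hy u
    obtain ⟨e, he⟩ := hy
    change (P' ∘L D y).inverse ((P' ∘L D y) u) = u
    rw [← show (e : G₁ →L[ℝ] G₁) = P' ∘L D y from he, ContinuousLinearMap.inverse_equiv]
    simp

end Bilinear

namespace CompatibleTriple

section Lift

variable {E : Type*} [NormedAddCommGroup E] [NormedSpace ℝ E]
  {H : Type*} [TopologicalSpace H] {I : ModelWithCorners ℝ E H}
  {M : Type*} [TopologicalSpace M] [ChartedSpace H M] [IsManifold I ∞ M]
  {F : Type*} [NormedAddCommGroup F] [NormedSpace ℝ F]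
  {A : M → Type*} [TopologicalSpace (TotalSpace F A)]
  [∀ x, TopologicalSpace (A x)] [∀ x, AddCommGroup (A x)] [∀ x, Module ℝ (A x)]
  [∀ x, IsTopologicalAddGroup (A x)] [∀ x, ContinuousSMul ℝ (A x)]
  [FiberBundle F A] [VectorBundle ℝ F A]
  {𝒜 : LieAlgebroid I F A} [FiniteDimensional ℝ F]
  {E' : Type*} [NormedAddCommGroup E'] [NormedSpace ℝ E'] [FiniteDimensional ℝ E']
  {H' : Type*} [TopologicalSpace H'] {I' : ModelWithCorners ℝ E' H'}
  {O : Type*} [TopologicalSpace O] [ChartedSpace H' O]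
  {ι : O → M}

/-- `σ` lifts the tangent vectors of `O` to `E²`. -/
def IsLift (T : CompatibleTriple 𝒜) (I' : ModelWithCorners ℝ E' H') (ι : O → M)
    (σ : ∀ q : O, TangentSpace I' q →L[ℝ] A (ι q)) : Prop :=
  ∀ q X, σ q X ∈ T.E2 (ι q) ∧ 𝒜.anchor (ι q) (σ q X) = mfderiv I' I ι q X

/-- Lifts to `E²` exist because `ρ(E²) = Λ`; they are linear in the tangent vector because they are
unique. -/
theorem exists_isLift (T : CompatibleTriple 𝒜) (hJ : ∀ p, ∀ a ∈ T.L2 p, T.J.toFun p a ∈ T.L2 p)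
    (hι : IsIntegralSubmanifold I' T.Λ ι) :
    ∃ σ : ∀ q : O, TangentSpace I' q →L[ℝ] A (ι q), T.IsLift I' ι σ := by
  have h : ∀ q (X : TangentSpace I' q), ∃ a ∈ T.E2 (ι q),
      𝒜.anchor (ι q) a = mfderiv I' I ι q X := by
    intro q X
    refine T.exists_mem_E2 ?_
    rw [← hι.range_mfderiv q]
    exact ⟨X, rfl⟩
  choose σ hσ hσ' using h
  have hfd : ∀ q : O, FiniteDimensional ℝ (TangentSpace I' q) := fun q =>
    inferInstanceAs (FiniteDimensional ℝ E')
  have hT2 : ∀ q : O, T2Space (TangentSpace I' q) := fun q => inferInstanceAs (T2Space E')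
  set τ : ∀ q : O, TangentSpace I' q →ₗ[ℝ] A (ι q) := fun q =>
    { toFun := σ q
      map_add' := fun X Y => eq_of_anchor_eq (hJ _) (hσ _ _)
        (Submodule.add_mem _ (hσ _ _) (hσ _ _)) (by rw [hσ', map_add, map_add, hσ', hσ'])
      map_smul' := fun c X => eq_of_anchor_eq (hJ _) (hσ _ _)
        (Submodule.smul_mem _ _ (hσ _ _)) (by
          rw [RingHom.id_apply, hσ', map_smul, map_smul, hσ']) }
  exact ⟨fun q => ⟨τ q, LinearMap.continuous_of_finiteDimensional _⟩,
    fun q X => ⟨hσ q X, hσ' q X⟩⟩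

variable [I'.Boundaryless] [IsManifold I' ∞ O]
  [I.Boundaryless] [FiniteDimensional ℝ E] [T2Space M] [ContMDiffVectorBundle ∞ F A I]

/-- A lift in the coordinates around `q₀` and `ι q₀`. -/
noncomputable def liftCoord (σ : ∀ q : O, TangentSpace I' q →L[ℝ] A (ι q)) (q₀ q : O) :
    E' →L[ℝ] F :=
  coframe F A (ι q₀) (ι q) ∘L σ q ∘L frame E' (fun q : O => TangentSpace I' q) q₀ q

/-- The coordinates `l` of the lift satisfy `R l = D v` and `l ⊥ ker R`. Constant rank, `R W R = R`,
makes `P = W R` a projection with kernel `ker R`, and both conditions enter one square system `Θ l =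
θ v`, namely `G(l, b - P b) + G(P l, P b) = G(W D v, P b)` for all `b`. Its smooth left side is
invertible: if `Θ a = 0`, testing on `P a` gives `P a = 0`, and testing on `a` then gives `a = 0`.
-/
theorem contMDiffAt_liftCoord {T : CompatibleTriple 𝒜}
    (hJ : ∀ p, ∀ a ∈ T.L2 p, T.J.toFun p a ∈ T.L2 p)
    (hι : IsIntegralSubmanifold I' T.Λ ι) {σ : ∀ q : O, TangentSpace I' q →L[ℝ] A (ι q)}
    (hσ : T.IsLift I' ι σ) (q₀ : O) :
    ContMDiffAt I' 𝓘(ℝ, E' →L[ℝ] F) ∞ (liftCoord (F := F) σ q₀) q₀ := by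
  set p := ι q₀ with hp
  have hιc : Tendsto ι (𝓝 q₀) (𝓝 p) := hι.contMDiff.continuous.continuousAt
  set R : O → F →L[ℝ] E := fun q => anchorCoord 𝒜 p (ι q) with hR
  have hRs : ContMDiffAt I' 𝓘(ℝ, F →L[ℝ] E) ∞ R q₀ :=
    (contMDiffAt_anchorCoord p).comp q₀ (hι.contMDiff q₀)
  set G : O → F →L[ℝ] F →L[ℝ] ℝ := fun q => T.gCoord p (ι q) with hG
  have hGs : ContMDiffAt I' 𝓘(ℝ, F →L[ℝ] F →L[ℝ] ℝ) ∞ G q₀ :=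
    (T.contMDiffAt_gCoord p).comp q₀ (hι.contMDiff q₀)
  set D := mfderivCoord I I' ι q₀ with hD
  have hDs : ContMDiffAt I' 𝓘(ℝ, E' →L[ℝ] E) ∞ D q₀ := contMDiffAt_mfderivCoord hι.contMDiff q₀
  obtain ⟨W, hW₀, hWs, hW⟩ := exists_smooth_outer_inverse (R q₀)
  have hRW := T.eventually_anchorCoord_comp_outer_inverse hι q₀ hW₀ (hWs 0).continuousAt hW
  have hWR : ContMDiffAt I' 𝓘(ℝ, E →L[ℝ] F) ∞ (fun q => W (R q)) q₀ :=
    (hWs ∞).comp_contMDiffAt hRs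
  set P : O → F →L[ℝ] F := fun q => W (R q) ∘L R q with hP
  have hPs : ContMDiffAt I' 𝓘(ℝ, F →L[ℝ] F) ∞ P q₀ := hWR.clm_comp hRs
  set V : O → F →L[ℝ] F := fun q => ContinuousLinearMap.id ℝ F - P q with hV
  have hVs : ContMDiffAt I' 𝓘(ℝ, F →L[ℝ] F) ∞ V q₀ := contMDiffAt_const.sub hPs
  set Θ : O → F →L[ℝ] F →L[ℝ] ℝ := fun q =>
    (G q).bilinearComp (ContinuousLinearMap.id ℝ F) (V q) + (G q).bilinearComp (P q) (P q) with hΘ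
  have hΘs : ContMDiffAt I' 𝓘(ℝ, F →L[ℝ] F →L[ℝ] ℝ) ∞ Θ q₀ :=
    (contMDiffAt_bilinearComp hGs contMDiffAt_const hVs).add
      (contMDiffAt_bilinearComp hGs hPs hPs)
  set θ : O → E' →L[ℝ] F →L[ℝ] ℝ := fun q => (G q).bilinearComp (W (R q) ∘L D q) (P q) with hθ
  have hθs : ContMDiffAt I' 𝓘(ℝ, E' →L[ℝ] F →L[ℝ] ℝ) ∞ θ q₀ :=
    contMDiffAt_bilinearComp hGs (hWR.clm_comp hDs) hPs
  have hΘapp : ∀ q a b, Θ q a b = G q a (b - P q b) + G q (P q a) (P q b) := fun _ _ _ => rfl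
  have hGzero : ∀ {q}, ι q ∈ (trivializationAt F A p).baseSet → ∀ a, G q a a = 0 → a = 0 := by
    intro q hq a ha
    rw [hG] at ha
    rw [← coframe_frame hq a, T.eq_zero_of_g_self ((T.gCoord_apply hq a a).symm.trans ha),
      map_zero]
  have hbase := hιc ((trivializationAt F A p).open_baseSet.mem_nhds
      (FiberBundle.mem_baseSet_trivializationAt F A p))
  have hsrc := hιc ((chartAt H p).open_source.mem_nhds (mem_chart_source H p))
  have hequiv : ∀ᶠ q in 𝓝 q₀, ∃ e : F ≃L[ℝ] (F →L[ℝ] ℝ), (e : F →L[ℝ] F →L[ℝ] ℝ) = Θ q := by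
    filter_upwards [hbase, hRW] with q hq hRq
    refine exists_equiv_of_injective _ fun a ha => ?_
    have hPP : ∀ b, P q (P q b) = P q b := fun b =>
      congrArg (W (R q)) (DFunLike.congr_fun hRq b)
    have h₁ : P q a = 0 := by
      refine hGzero hq _ ?_
      have h := ha (P q a)
      rwa [hΘapp, hPP, sub_self, map_zero, zero_add] at h
    refine hGzero hq _ ?_
    have h := ha a
    rwa [hΘapp, h₁, sub_zero, map_zero, add_zero] at h
  obtain ⟨e₀, he₀⟩ := hequiv.self_of_nhds
  have hinv : ContMDiffAt I' 𝓘(ℝ, (F →L[ℝ] ℝ) →L[ℝ] F) ∞ (fun q => (Θ q).inverse) q₀ := by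
    refine ContDiffAt.comp_contMDiffAt (g := fun L : F →L[ℝ] F →L[ℝ] ℝ => L.inverse) ?_ hΘs
    have hcomp : CompleteSpace F := FiniteDimensional.complete ℝ F
    rw [← he₀]
    exact contDiffAt_map_inverse e₀
  refine (hinv.clm_comp hθs).congr_of_eventuallyEq ?_
  filter_upwards [hbase, hsrc, hRW, hequiv] with q hq hq' hRq ⟨e, he⟩
  ext v
  rw [← he, ContinuousLinearMap.inverse_equiv, ContinuousLinearMap.comp_apply,
    ContinuousLinearEquiv.coe_coe, ContinuousLinearEquiv.eq_symm_apply]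
  ext b
  set X := frame E' (fun q : O => TangentSpace I' q) q₀ q v with hX
  have hf : frame F A p (ι q) (liftCoord (F := F) σ q₀ q v) = σ q X := frame_coframe hq _
  have hRl : R q (liftCoord (F := F) σ q₀ q v) = D q v := by
    rw [hR]
    change anchorCoord 𝒜 p (ι q) _ = _
    rw [anchorCoord_apply hq', hf, (hσ q X).2, hD, mfderivCoord_apply hι.contMDiff hq']
  have hGV : G q (liftCoord (F := F) σ q₀ q v) (b - P q b) = 0 := by
    rw [hG]
    refine (T.gCoord_apply hq _ _).trans ?_
    rw [hf]
    refine g_E2_L (hJ _) (hσ q X).1 (T.mem_L.2 ?_)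
    apply mvfderiv_extChartAt_injective hq'
    rw [← anchorCoord_apply hq', map_zero, map_sub, sub_eq_zero]
    exact (DFunLike.congr_fun hRq b).symm
  have e₁ : e (liftCoord (F := F) σ q₀ q v) b = Θ q (liftCoord (F := F) σ q₀ q v) b := by
    rw [← he]
    rfl
  rw [e₁, hΘapp, hGV, zero_add]
  change G q (W (R q) (R q (liftCoord (F := F) σ q₀ q v))) (P q b) = G q (W (R q) (D q v)) (P q b)
  rw [hRl]

end Lift

end CompatibleTriple

end CompatTriples

namespace CompatTriples

open Filter Topology

/-- The pullback of a bilinear form along a linear map. -/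
noncomputable def pullbackBilin {V W : Type*} [TopologicalSpace V] [AddCommGroup V] [Module ℝ V]
    [TopologicalSpace W] [AddCommGroup W] [Module ℝ W] (B : W →L[ℝ] W →L[ℝ] ℝ) (S : V →L[ℝ] W) :
    V →L[ℝ] V →L[ℝ] ℝ :=
  ContinuousLinearMap.precomp ℝ S ∘L B ∘L S

/-! ### The induced tensors on an integral submanifold. -/

section Pullback

variable {E : Type*} [NormedAddCommGroup E] [NormedSpace ℝ E]
  {H : Type*} [TopologicalSpace H] {I : ModelWithCorners ℝ E H}
  {M : Type*} [TopologicalSpace M] [ChartedSpace H M] [IsManifold I ∞ M]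
  {F : Type*} [NormedAddCommGroup F] [NormedSpace ℝ F]
  {A : M → Type*} [TopologicalSpace (TotalSpace F A)]
  [∀ x, TopologicalSpace (A x)] [∀ x, AddCommGroup (A x)] [∀ x, Module ℝ (A x)]
  [FiberBundle F A] [VectorBundle ℝ F A]
  {E' : Type*} [NormedAddCommGroup E'] [NormedSpace ℝ E']
  {H' : Type*} [TopologicalSpace H'] {I' : ModelWithCorners ℝ E' H'}
  {O : Type*} [TopologicalSpace O] [ChartedSpace H' O] [IsManifold I' ∞ O]
  {ι : O → M}

theorem contMDiff_pullbackBilin (hι : ContMDiff I' I ∞ ι)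
    {B : ∀ x : M, A x →L[ℝ] A x →L[ℝ] ℝ} (hB : ContMDiff I (I.prod 𝓘(ℝ, F →L[ℝ] F →L[ℝ] ℝ)) ∞
      (fun x => TotalSpace.mk' (F →L[ℝ] F →L[ℝ] ℝ) (E := fun x : M => A x →L[ℝ] A x →L[ℝ] ℝ)
        x (B x)))
    {σ : ∀ q : O, TangentSpace I' q →L[ℝ] A (ι q)}
    (hσ : ∀ q₀, ContMDiffAt I' 𝓘(ℝ, E' →L[ℝ] F) ∞
      (CompatibleTriple.liftCoord (F := F) σ q₀) q₀) :
    ContMDiff I' (I'.prod 𝓘(ℝ, E' →L[ℝ] E' →L[ℝ] ℝ)) ∞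
      (fun q => TotalSpace.mk' (E' →L[ℝ] E' →L[ℝ] ℝ)
        (E := fun q : O => TangentSpace I' q →L[ℝ] TangentSpace I' q →L[ℝ] ℝ)
        q (pullbackBilin (B (ι q)) (σ q))) := by
  intro q₀
  rw [contMDiffAt_hom_bundle]
  refine ⟨contMDiffAt_id, ?_⟩
  have h := contMDiffAt_bilinearComp
    ((((contMDiffAt_hom_bundle _).1 (hB (ι q₀))).2).comp q₀ (hι q₀)) (hσ q₀) (hσ q₀)
  refine h.congr_of_eventuallyEq ?_
  have hιc : Tendsto ι (𝓝 q₀) (𝓝 (ι q₀)) := hι.continuous.continuousAt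
  filter_upwards [hιc ((trivializationAt F A (ι q₀)).open_baseSet.mem_nhds
      (FiberBundle.mem_baseSet_trivializationAt F A (ι q₀))),
    (trivializationAt E' (fun q : O => TangentSpace I' q) q₀).open_baseSet.mem_nhds
      (FiberBundle.mem_baseSet_trivializationAt E' _ q₀)] with q hq hq'
  ext u v
  refine (inCoordinates_bilin_apply (A := fun q : O => TangentSpace I' q) hq' _ u v).trans ?_
  refine Eq.trans ?_ (inCoordinates_bilin_apply hq (B (ι q))
    (CompatibleTriple.liftCoord (F := F) σ q₀ q u)
    (CompatibleTriple.liftCoord (F := F) σ q₀ q v)).symm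
  simp only [CompatibleTriple.liftCoord, ContinuousLinearMap.comp_apply, frame_coframe hq]
  rfl

end Pullback

namespace CompatibleTriple

section Induced

variable {E : Type*} [NormedAddCommGroup E] [NormedSpace ℝ E]
  {H : Type*} [TopologicalSpace H] {I : ModelWithCorners ℝ E H}
  {M : Type*} [TopologicalSpace M] [ChartedSpace H M] [IsManifold I ∞ M]
  {F : Type*} [NormedAddCommGroup F] [NormedSpace ℝ F]
  {A : M → Type*} [TopologicalSpace (TotalSpace F A)]
  [∀ x, TopologicalSpace (A x)] [∀ x, AddCommGroup (A x)] [∀ x, Module ℝ (A x)]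
  [∀ x, IsTopologicalAddGroup (A x)] [∀ x, ContinuousSMul ℝ (A x)]
  [FiberBundle F A] [VectorBundle ℝ F A]
  {𝒜 : LieAlgebroid I F A}
  {E' : Type*} [NormedAddCommGroup E'] [NormedSpace ℝ E']
  {H' : Type*} [TopologicalSpace H'] {I' : ModelWithCorners ℝ E' H'}
  {O : Type*} [TopologicalSpace O] [ChartedSpace H' O]
  {ι : O → M} {T : CompatibleTriple 𝒜}

theorem IsLift.injective {σ : ∀ q : O, TangentSpace I' q →L[ℝ] A (ι q)} (hσ : T.IsLift I' ι σ)
    (hι : IsIntegralSubmanifold I' T.Λ ι) (q : O) : Function.Injective (σ q) := by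
  intro X Y h
  apply hι.injective_mfderiv q
  rw [← (hσ q X).2, ← (hσ q Y).2, h]

variable [FiniteDimensional ℝ E]

/-- A pointwise choice, not claimed to be smooth in `q`. Smoothness of `J_O` comes from a separate
local left inverse, which agrees with it on the range of the differential. -/
theorem exists_left_inverse_mfderiv (hι : IsIntegralSubmanifold I' T.Λ ι) :
    ∃ δ : ∀ q : O, TangentSpace I (ι q) →L[ℝ] TangentSpace I' q,
      ∀ q X, δ q (mfderiv I' I ι q X) = X := by
  have h : ∀ q : O, ∃ δ : TangentSpace I (ι q) →L[ℝ] TangentSpace I' q,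
      ∀ X, δ (mfderiv I' I ι q X) = X := by
    intro q
    have hfd : FiniteDimensional ℝ (TangentSpace I (ι q)) :=
      inferInstanceAs (FiniteDimensional ℝ E)
    have hT2 : T2Space (TangentSpace I (ι q)) := inferInstanceAs (T2Space E)
    obtain ⟨P, hP⟩ := (mfderiv I' I ι q :
      TangentSpace I' q →ₗ[ℝ] TangentSpace I (ι q)).exists_leftInverse_of_injective
        (LinearMap.ker_eq_bot.2 (hι.injective_mfderiv q))
    exact ⟨⟨P, LinearMap.continuous_of_finiteDimensional P⟩, fun X => LinearMap.congr_fun hP X⟩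
  choose δ hδ using h
  exact ⟨δ, hδ⟩

variable [FiniteDimensional ℝ E'] [I'.Boundaryless] [IsManifold I' ∞ O]
  [I.Boundaryless] [T2Space M] [FiniteDimensional ℝ F] [ContMDiffVectorBundle ∞ F A I]

/-- The 2-form induced on an integral submanifold. -/
noncomputable def inducedForm (hJ : ∀ p, ∀ a ∈ T.L2 p, T.J.toFun p a ∈ T.L2 p)
    (hι : IsIntegralSubmanifold I' T.Λ ι) {σ : ∀ q : O, TangentSpace I' q →L[ℝ] A (ι q)}
    (hσ : T.IsLift I' ι σ) : TwoForm I' E' (fun q : O => TangentSpace I' q) where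
  toFun q := pullbackBilin (T.form.toFun (ι q)) (σ q)
  alternating _ _ := T.form.alternating _ _
  contMDiff := contMDiff_pullbackBilin hι.contMDiff T.form.contMDiff
    (contMDiffAt_liftCoord hJ hι hσ)

/-- The metric induced on an integral submanifold. -/
noncomputable def inducedMetric (hJ : ∀ p, ∀ a ∈ T.L2 p, T.J.toFun p a ∈ T.L2 p)
    (hι : IsIntegralSubmanifold I' T.Λ ι) {σ : ∀ q : O, TangentSpace I' q →L[ℝ] A (ι q)}
    (hσ : T.IsLift I' ι σ) :
    ContMDiffRiemannianMetric I' ∞ E' (fun q : O => TangentSpace I' q) where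
  inner q := pullbackBilin (T.g.inner (ι q)) (σ q)
  symm q X Y := T.g.symm _ _ _
  pos q X hX := T.g.pos _ _ fun h => hX (hσ.injective hι q (h.trans (map_zero _).symm))
  isVonNBounded q := by
    obtain ⟨δ, hδ⟩ := exists_left_inverse_mfderiv hι
    -- `δ ∘ ρ` is a left inverse of `σ`, so the unit ball of the induced metric lies in the image of
    -- that of `g` under a continuous linear map.
    refine ((T.g.isVonNBounded (ι q)).image (δ q ∘L 𝒜.anchor (ι q))).subset fun X hX => ?_
    refine ⟨σ q X, hX, ?_⟩
    rw [ContinuousLinearMap.comp_apply, (hσ q X).2, hδ]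
  contMDiff := contMDiff_pullbackBilin hι.contMDiff T.g.contMDiff
    (contMDiffAt_liftCoord hJ hι hσ)

/-- As `E²` is `J`-invariant, `ρ(J σ X)` is tangent to `O` and defines `j X`. Then `σ(j X)` and `J(σ
X)` lie in `E²` with equal anchors, hence coincide, so the identity `j² = -1` is inherited through
the injective `σ`. -/
theorem exists_inducedJ (hJ : ∀ p, ∀ a ∈ T.L2 p, T.J.toFun p a ∈ T.L2 p)
    (hι : IsIntegralSubmanifold I' T.Λ ι) {σ : ∀ q : O, TangentSpace I' q →L[ℝ] A (ι q)}
    (hσ : T.IsLift I' ι σ) :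
    ∃ j : AlmostComplexStructure I' E' (fun q : O => TangentSpace I' q),
      ∀ q X, σ q (j.toFun q X) = T.J.toFun (ι q) (σ q X) := by
  obtain ⟨δ, hδ⟩ := exists_left_inverse_mfderiv hι
  set j : ∀ q : O, TangentSpace I' q →L[ℝ] TangentSpace I' q := fun q =>
    δ q ∘L 𝒜.anchor (ι q) ∘L T.J.toFun (ι q) ∘L σ q with hj
  have hdj : ∀ q X, mfderiv I' I ι q (j q X) = 𝒜.anchor (ι q) (T.J.toFun (ι q) (σ q X)) := by
    intro q X
    have h : 𝒜.anchor (ι q) (T.J.toFun (ι q) (σ q X)) ∈ T.Λ (ι q) :=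
      ⟨_, Submodule.mem_sup_left (J_mem_E2 (hJ _) (hσ q X).1), rfl⟩
    rw [← hι.range_mfderiv q] at h
    obtain ⟨Y, hY⟩ := h
    have hY' : mfderiv I' I ι q Y = 𝒜.anchor (ι q) (T.J.toFun (ι q) (σ q X)) := hY
    have : j q X = Y := by
      change δ q (𝒜.anchor (ι q) (T.J.toFun (ι q) (σ q X))) = Y
      rw [← hY', hδ]
    rw [this, hY']
  have hσj : ∀ q X, σ q (j q X) = T.J.toFun (ι q) (σ q X) := fun q X =>
    eq_of_anchor_eq (hJ _) (hσ q _).1 (J_mem_E2 (hJ _) (hσ q X).1) (by rw [(hσ q _).2, hdj])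
  refine ⟨⟨j, ?_, fun q X => ?_⟩, hσj⟩
  · intro q₀
    rw [contMDiffAt_hom_bundle]
    refine ⟨contMDiffAt_id, ?_⟩
    have hDs := contMDiffAt_mfderivCoord (I := I) hι.contMDiff q₀
    have hιc : Tendsto ι (𝓝 q₀) (𝓝 (ι q₀)) := hι.contMDiff.continuous.continuousAt
    obtain ⟨L, hL, hLD⟩ := exists_contMDiffAt_left_inverse hDs (mfderivCoord_injective hι q₀)
    have h := hL.clm_comp (((contMDiffAt_anchorCoord (𝒜 := 𝒜) (ι q₀)).comp q₀
      (hι.contMDiff q₀)).clm_comp (((T.contMDiffAt_JCoord (ι q₀)).comp q₀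
      (hι.contMDiff q₀)).clm_comp (contMDiffAt_liftCoord hJ hι hσ q₀)))
    refine h.congr_of_eventuallyEq ?_
    filter_upwards [hLD, hιc ((trivializationAt F A (ι q₀)).open_baseSet.mem_nhds
        (FiberBundle.mem_baseSet_trivializationAt F A (ι q₀))),
      hιc ((chartAt H (ι q₀)).open_source.mem_nhds (mem_chart_source H (ι q₀))),
      (trivializationAt E' (fun q : O => TangentSpace I' q) q₀).open_baseSet.mem_nhds
      (FiberBundle.mem_baseSet_trivializationAt E' _ q₀)] with q hLq hq hqs hq'
    ext u
    set X := frame E' (fun q : O => TangentSpace I' q) q₀ q u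
    change coframe E' (fun q : O => TangentSpace I' q) q₀ q (j q X) =
      L q (anchorCoord 𝒜 (ι q₀) (ι q) (T.JCoord (ι q₀) (ι q) (coframe F A (ι q₀) (ι q) (σ q X))))
    rw [anchorCoord_apply hqs, T.JCoord_apply hq, frame_coframe hq, ← hdj,
      ← hLq (coframe E' (fun q : O => TangentSpace I' q) q₀ q (j q X)),
      mfderivCoord_apply hι.contMDiff hqs, frame_coframe hq']
  · apply hσ.injective hι q
    rw [hσj, hσj, T.J.sq_eq_neg, map_neg]

end Induced

end CompatibleTriple

end CompatTriples

namespace CompatTriples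

open Filter Topology VectorField

theorem TwoForm.antisymm {E : Type*} [NormedAddCommGroup E] [NormedSpace ℝ E]
    {H : Type*} [TopologicalSpace H] {I : ModelWithCorners ℝ E H}
    {M : Type*} [TopologicalSpace M] [ChartedSpace H M]
    {F : Type*} [NormedAddCommGroup F] [NormedSpace ℝ F]
    {A : M → Type*} [TopologicalSpace (TotalSpace F A)]
    [∀ x, TopologicalSpace (A x)] [∀ x, AddCommGroup (A x)] [∀ x, Module ℝ (A x)]
    [∀ x, IsTopologicalAddGroup (A x)] [∀ x, ContinuousSMul ℝ (A x)]
    [FiberBundle F A] [VectorBundle ℝ F A] (η : TwoForm I F A) (x : M) (v w : A x) :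
    η.toFun x v w = -η.toFun x w v := by
  have h := η.alternating x (v + w)
  simp only [map_add, add_apply, η.alternating, zero_add, add_zero] at h
  linarith

/-! ### The exterior derivative on vector fields that are merely differentiable at a point. -/

section TangentForm

variable {E : Type*} [NormedAddCommGroup E] [NormedSpace ℝ E]
  {H : Type*} [TopologicalSpace H] {I : ModelWithCorners ℝ E H}
  {M : Type*} [TopologicalSpace M] [ChartedSpace H M] [IsManifold I ∞ M]

variable (I) in
/-- A vector field is differentiable at a point. -/
abbrev MDiffFieldAt (V : Π x : M, TangentSpace I x) (x : M) : Prop :=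
  MDifferentiableAt I I.tangent (fun y => (⟨y, V y⟩ : TangentBundle I M)) x

namespace TwoForm

variable (η : TwoForm I E (fun x : M => TangentSpace I x))

/-- The exterior derivative of a 2-form on a manifold, evaluated on arbitrary vector fields. -/
noncomputable def fieldExtDeriv (x : M) (V₀ V₁ V₂ : Π y : M, TangentSpace I y) : ℝ :=
  mvfderiv I (fun y => η.toFun y (V₁ y) (V₂ y)) x (V₀ x)
    - mvfderiv I (fun y => η.toFun y (V₀ y) (V₂ y)) x (V₁ x)
    + mvfderiv I (fun y => η.toFun y (V₀ y) (V₁ y)) x (V₂ x)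
    - η.toFun x (mlieBracket I V₀ V₁ x) (V₂ x)
    + η.toFun x (mlieBracket I V₀ V₂ x) (V₁ x)
    - η.toFun x (mlieBracket I V₁ V₂ x) (V₀ x)

theorem mvfderiv_swap (V W : Π y : M, TangentSpace I y) (x : M) (v : TangentSpace I x) :
    mvfderiv I (fun y => η.toFun y (V y) (W y)) x v =
      -mvfderiv I (fun y => η.toFun y (W y) (V y)) x v := by
  have h : (fun y => η.toFun y (V y) (W y)) = -(fun y => η.toFun y (W y) (V y)) :=
    funext fun y => η.antisymm y _ _
  rw [h, mvfderiv_neg]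
  rfl

/-- Cyclic symmetry reduces tensoriality in all three arguments to tensoriality in the first. -/
theorem fieldExtDeriv_cyclic (x : M) (V₀ V₁ V₂ : Π y : M, TangentSpace I y) :
    η.fieldExtDeriv x V₀ V₁ V₂ = η.fieldExtDeriv x V₁ V₂ V₀ := by
  simp only [fieldExtDeriv]
  rw [η.mvfderiv_swap V₂ V₀, η.mvfderiv_swap V₁ V₀, mlieBracket_swap_apply (V := V₁) (W := V₀),
    mlieBracket_swap_apply (V := V₂) (W := V₀)]
  simp only [map_neg, neg_apply]
  ring

theorem mdifferentiableAt_apply {V W : Π y : M, TangentSpace I y} {x : M}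
    (hV : MDiffFieldAt I V x) (hW : MDiffFieldAt I W x) :
    MDifferentiableAt I 𝓘(ℝ, ℝ) (fun y => η.toFun y (V y) (W y)) x := by
  have h := MDifferentiableAt.clm_bundle_apply₂ (F₁ := E) (F₂ := E) (F₃ := ℝ)
    (E₃ := fun _ : M => ℝ) ((η.contMDiff x).mdifferentiableAt (by simp)) hV hW
  exact ((mdifferentiableAt_section _ _).1 h)

variable [CompleteSpace E]

/-- The derivatives of `f` coming from the product rule cancel those coming from the brackets `[f V,
V₁]` and `[f V, V₂]`. -/
theorem tensorialAt_fieldExtDeriv {x : M} {V₁ V₂ : Π y : M, TangentSpace I y}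
    (h₁ : MDiffFieldAt I V₁ x) (h₂ : MDiffFieldAt I V₂ x) :
    TensorialAt I E (fun V₀ => η.fieldExtDeriv x V₀ V₁ V₂) x where
  smul {f V} hf hV := by
    have e : ∀ W : Π y : M, TangentSpace I y, (fun y => η.toFun y ((f • V) y) (W y)) =
        f * (fun y => η.toFun y (V y) (W y)) := by
      intro W
      ext y
      simp
    simp only [fieldExtDeriv, e]
    rw [mvfderiv_mul hf (η.mdifferentiableAt_apply hV h₁),
      mvfderiv_mul hf (η.mdifferentiableAt_apply hV h₂), mlieBracket_smul_left hf hV,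
      mlieBracket_smul_left hf hV]
    simp only [Pi.smul_apply', map_smul, map_add, add_apply, smul_apply, smul_eq_mul, neg_smul,
      map_neg, neg_apply]
    ring
  add {V V'} hV hV' := by
    have e : ∀ W : Π y : M, TangentSpace I y, (fun y => η.toFun y ((V + V') y) (W y)) =
        (fun y => η.toFun y (V y) (W y)) + fun y => η.toFun y (V' y) (W y) := by
      intro W
      ext y
      simp
    simp only [fieldExtDeriv, e]
    rw [mvfderiv_add (η.mdifferentiableAt_apply hV h₁) (η.mdifferentiableAt_apply hV' h₁),
      mvfderiv_add (η.mdifferentiableAt_apply hV h₂) (η.mdifferentiableAt_apply hV' h₂),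
      mlieBracket_add_left hV hV', mlieBracket_add_left hV hV']
    simp only [Pi.add_apply, map_add, add_apply]
    ring

/-- The exterior derivative depends only on the values of the vector fields at the point. -/
theorem fieldExtDeriv_congr [FiniteDimensional ℝ E] {x : M}
    {V₀ V₁ V₂ W₀ W₁ W₂ : Π y : M, TangentSpace I y}
    (h₀ : MDiffFieldAt I V₀ x) (h₁ : MDiffFieldAt I V₁ x) (h₂ : MDiffFieldAt I V₂ x)
    (k₀ : MDiffFieldAt I W₀ x) (k₁ : MDiffFieldAt I W₁ x) (k₂ : MDiffFieldAt I W₂ x)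
    (e₀ : V₀ x = W₀ x) (e₁ : V₁ x = W₁ x) (e₂ : V₂ x = W₂ x) :
    η.fieldExtDeriv x V₀ V₁ V₂ = η.fieldExtDeriv x W₀ W₁ W₂ := by
  have : IsManifold I (1 + 1) M := IsManifold.of_le (n := ∞) (WithTop.coe_le_coe.2 le_top)
  -- Replace the first argument, rotate, and repeat; three rotations restore the order.
  rw [(η.tensorialAt_fieldExtDeriv h₁ h₂).pointwise h₀ k₀ e₀, η.fieldExtDeriv_cyclic,
    (η.tensorialAt_fieldExtDeriv h₂ k₀).pointwise h₁ k₁ e₁, η.fieldExtDeriv_cyclic,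
    (η.tensorialAt_fieldExtDeriv k₀ k₁).pointwise h₂ k₂ e₂, η.fieldExtDeriv_cyclic]

end TwoForm

end TangentForm

section Tangent

variable {E : Type*} [NormedAddCommGroup E] [NormedSpace ℝ E]
  {H : Type*} [TopologicalSpace H] {I : ModelWithCorners ℝ E H}
  {M : Type*} [TopologicalSpace M] [ChartedSpace H M] [IsManifold I ∞ M]

theorem mdifferentiableAt_mvfderiv_extChartAt {V : Π x : M, TangentSpace I x} {p : M}
    (hV : MDiffFieldAt I V p) :
    MDifferentiableAt I 𝓘(ℝ, E) (fun x => mvfderiv I (extChartAt I p) x (V x)) p := by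
  refine ((mdifferentiableAt_section _ _).1 hV).congr_of_eventuallyEq ?_
  filter_upwards [(chartAt H p).open_source.mem_nhds (mem_chart_source H p)] with x hx
  rw [← coframe_tangent hx, ← trivializationAt_snd_eq_coframe (by simpa using hx)]

end Tangent

/-! ### Brackets of related vector fields. -/

section Related

variable {E : Type*} [NormedAddCommGroup E] [NormedSpace ℝ E] [CompleteSpace E]
  {H : Type*} [TopologicalSpace H] {I : ModelWithCorners ℝ E H} [I.Boundaryless]
  {M : Type*} [TopologicalSpace M] [ChartedSpace H M] [IsManifold I ∞ M]
  {E' : Type*} [NormedAddCommGroup E'] [NormedSpace ℝ E'] [CompleteSpace E']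
  {H' : Type*} [TopologicalSpace H'] {I' : ModelWithCorners ℝ E' H'} [I'.Boundaryless]
  {O : Type*} [TopologicalSpace O] [ChartedSpace H' O] [IsManifold I' ∞ O]
  {ι : O → M}

/-- The brackets of `ι`-related vector fields are `ι`-related. -/
theorem mfderiv_mlieBracket_of_related (hι : ContMDiff I' I ∞ ι)
    {V W : Π q : O, TangentSpace I' q} {V' W' : Π x : M, TangentSpace I x} {q : O}
    (hV : MDiffFieldAt I' V q) (hW : MDiffFieldAt I' W q)
    (hV' : MDiffFieldAt I V' (ι q)) (hW' : MDiffFieldAt I W' (ι q))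
    (h : ∀ q, mfderiv I' I ι q (V q) = V' (ι q)) (k : ∀ q, mfderiv I' I ι q (W q) = W' (ι q)) :
    mfderiv I' I ι q (mlieBracket I' V W q) = mlieBracket I V' W' (ι q) := by
  set p := ι q with hp
  set φ := extChartAt I p
  set α : M → E := fun x => mvfderiv I φ x (V' x)
  set β : M → E := fun x => mvfderiv I φ x (W' x)
  have hα : MDifferentiableAt I 𝓘(ℝ, E) α p := mdifferentiableAt_mvfderiv_extChartAt hV'
  have hβ : MDifferentiableAt I 𝓘(ℝ, E) β p := mdifferentiableAt_mvfderiv_extChartAt hW'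
  have hιd := hι.mdifferentiable (by simp)
  have hφ : ContMDiffAt I 𝓘(ℝ, E) ∞ φ p := contMDiffAt_extChartAt
  have hιc : Tendsto ι (𝓝 q) (𝓝 p) := hι.continuous.continuousAt
  have hφd : ∀ᶠ y in 𝓝 q, MDifferentiableAt I 𝓘(ℝ, E) φ (ι y) :=
    hιc.eventually (ContMDiffAt.eventually_mdifferentiableAt hφ)
  -- Both brackets are tested on the chart map: the one on `O` through `φ ∘ ι`, the one on `M`
  -- through `φ`. The chain rule matches the two commutators, and `dφ` is injective.
  have e₁ := mfderiv_mlieBracket (φ := fun y => φ (ι y)) (hφ.comp q (hι q)) hV hW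
    (MDifferentiableAt.comp (g := α) q hα (hιd q)) (MDifferentiableAt.comp (g := β) q hβ (hιd q))
    (hφd.mono fun y hy => by
      have h₁ := mfderiv_comp_apply y hy (hιd y) (V y)
      rw [h] at h₁
      exact h₁)
    (hφd.mono fun y hy => by
      have h₁ := mfderiv_comp_apply y hy (hιd y) (W y)
      rw [k] at h₁
      exact h₁)
  have e₂ := mfderiv_mlieBracket hφ hV' hW' hα hβ (Eventually.of_forall fun _ => rfl)
    (Eventually.of_forall fun _ => rfl)
  have e₃ := mfderiv_comp_apply q hβ (hιd q) (V q)
  have e₄ := mfderiv_comp_apply q hα (hιd q) (W q)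
  have e₅ := mfderiv_comp_apply q hφd.self_of_nhds (hιd q) (mlieBracket I' V W q)
  rw [h] at e₃
  rw [k] at e₄
  apply mvfderiv_extChartAt_injective (mem_chart_source H p)
  rw [e₂]
  refine (e₅.symm.trans e₁).trans ?_
  exact congrArg₂ (fun a b : E => a - b) e₃ e₄

end Related

end CompatTriples

namespace CompatTriples

open Filter Topology VectorField

namespace CompatibleTriple

/-! ### Uniqueness of the induced triple. -/

section Uniqueness

variable {E : Type*} [NormedAddCommGroup E] [NormedSpace ℝ E]
  {H : Type*} [TopologicalSpace H] {I : ModelWithCorners ℝ E H}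
  {M : Type*} [TopologicalSpace M] [ChartedSpace H M] [IsManifold I ∞ M]
  {F : Type*} [NormedAddCommGroup F] [NormedSpace ℝ F]
  {A : M → Type*} [TopologicalSpace (TotalSpace F A)]
  [∀ x, TopologicalSpace (A x)] [∀ x, AddCommGroup (A x)] [∀ x, Module ℝ (A x)]
  [∀ x, IsTopologicalAddGroup (A x)] [∀ x, ContinuousSMul ℝ (A x)]
  [FiberBundle F A] [VectorBundle ℝ F A]
  {𝒜 : LieAlgebroid I F A} [FiniteDimensional ℝ F]
  {E' : Type*} [NormedAddCommGroup E'] [NormedSpace ℝ E']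
  {H' : Type*} [TopologicalSpace H'] {I' : ModelWithCorners ℝ E' H'}
  {O : Type*} [TopologicalSpace O] [ChartedSpace H' O] [IsManifold I' ∞ O]
  {ι : O → M} {T : CompatibleTriple 𝒜}

/-- Every tangent vector of `O` has some lift in `E²`, so the defining equations fix all values,
those of `J_O` through injectivity of the differential of `ι`. -/
theorem eq_of_isInducedTriple (hι : IsIntegralSubmanifold I' T.Λ ι)
    {ℬ : LieAlgebroid I' E' (fun q : O => TangentSpace I' q)} {S S' : CompatibleTriple ℬ}
    (hS : IsInducedTriple I' T ι S) (hS' : IsInducedTriple I' T ι S') : S = S' := by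
  have hE2 : ∀ q (X : TangentSpace I' q), ∃ a ∈ T.E2 (ι q),
      𝒜.anchor (ι q) a = mfderiv I' I ι q X := by
    intro q X
    refine T.exists_mem_E2 ?_
    rw [← hι.range_mfderiv q]
    exact ⟨X, rfl⟩
  obtain ⟨⟨w, hw, hw'⟩, ⟨j, hj, hj'⟩, ⟨g, hg₁, hg₂, hg₃, hg₄⟩, h₁, h₂, h₃⟩ := S
  obtain ⟨⟨w', kw, kw'⟩, ⟨j', kj, kj'⟩, ⟨g', kg₁, kg₂, kg₃, kg₄⟩, k₁, k₂, k₃⟩ := S'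
  obtain rfl : w = w' := by
    funext q
    ext X Y
    obtain ⟨a, ha, haX⟩ := hE2 q X
    obtain ⟨b, hb, hbY⟩ := hE2 q Y
    have ha' := Submodule.mem_sup_left (T := T.L1 (ι q)) ha
    have hb' := Submodule.mem_sup_left (T := T.L1 (ι q)) hb
    exact (hS.form_eq q X Y a b ha' hb' haX hbY).trans
      (hS'.form_eq q X Y a b ha' hb' haX hbY).symm
  obtain rfl : j = j' := by
    funext q
    ext X
    obtain ⟨a, ha, haX⟩ := hE2 q X
    exact hι.injective_mfderiv q ((hS.J_eq q X a ha haX).trans (hS'.J_eq q X a ha haX).symm)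
  obtain rfl : g = g' := by
    funext q
    ext X Y
    obtain ⟨a, ha, haX⟩ := hE2 q X
    obtain ⟨b, hb, hbY⟩ := hE2 q Y
    exact (hS.g_eq q X Y a b ha hb haX hbY).trans (hS'.g_eq q X Y a b ha hb haX hbY).symm
  rfl

end Uniqueness

/-! ### Closedness and existence of the induced triple. -/

section Closed

variable {E : Type*} [NormedAddCommGroup E] [NormedSpace ℝ E]
  {H : Type*} [TopologicalSpace H] {I : ModelWithCorners ℝ E H}
  {M : Type*} [TopologicalSpace M] [ChartedSpace H M] [IsManifold I ∞ M]
  {F : Type*} [NormedAddCommGroup F] [NormedSpace ℝ F]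
  {A : M → Type*} [TopologicalSpace (TotalSpace F A)]
  [∀ x, TopologicalSpace (A x)] [∀ x, AddCommGroup (A x)] [∀ x, Module ℝ (A x)]
  [∀ x, IsTopologicalAddGroup (A x)] [∀ x, ContinuousSMul ℝ (A x)]
  [FiberBundle F A] [VectorBundle ℝ F A]
  {𝒜 : LieAlgebroid I F A} [FiniteDimensional ℝ E] [FiniteDimensional ℝ F]
  {E' : Type*} [NormedAddCommGroup E'] [NormedSpace ℝ E'] [FiniteDimensional ℝ E']
  {H' : Type*} [TopologicalSpace H'] {I' : ModelWithCorners ℝ E' H'}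
  {O : Type*} [TopologicalSpace O] [ChartedSpace H' O] [IsManifold I' ∞ O]
  {ι : O → M} {T : CompatibleTriple 𝒜}

/-- The anchor of a section of `L^ω` is tangent to integral submanifolds. -/
theorem exists_related_field (hι : IsIntegralSubmanifold I' T.Λ ι) {s : Cₛ^∞⟮I; F, A⟯}
    (hs : ∀ x, s x ∈ orth (T.form.toFun x) (T.L x)) :
    ∃ Y : Π q : O, TangentSpace I' q, (∀ q, mfderiv I' I ι q (Y q) = 𝒜.anchor (ι q) (s (ι q))) ∧
      ∀ q, MDiffFieldAt I' Y q := by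
  have h : ∀ q : O, ∃ Y : TangentSpace I' q, mfderiv I' I ι q Y = 𝒜.anchor (ι q) (s (ι q)) := by
    intro q
    have h : 𝒜.anchor (ι q) (s (ι q)) ∈ T.Λ (ι q) := T.mem_Λ.2 ⟨_, hs _, rfl⟩
    rw [← hι.range_mfderiv q] at h
    exact h
  choose Y hY using h
  refine ⟨Y, hY, fun q₀ => ?_⟩
  have hιc : Tendsto ι (𝓝 q₀) (𝓝 (ι q₀)) := hι.contMDiff.continuous.continuousAt
  obtain ⟨L, hL, hLD⟩ := exists_contMDiffAt_left_inverse
    (contMDiffAt_mfderivCoord (I := I) hι.contMDiff q₀) (mfderivCoord_injective hι q₀)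
  have h := hL.clm_apply (((contMDiffAt_anchorCoord (𝒜 := 𝒜) (ι q₀)).comp q₀
    (hι.contMDiff q₀)).clm_apply ((contMDiffAt_coframe s (ι q₀)).comp q₀ (hι.contMDiff q₀)))
  refine (mdifferentiableAt_section _ _).2
    ((h.mdifferentiableAt (by simp)).congr_of_eventuallyEq ?_)
  filter_upwards [hLD, hιc ((trivializationAt F A (ι q₀)).open_baseSet.mem_nhds
      (FiberBundle.mem_baseSet_trivializationAt F A (ι q₀))),
    hιc ((chartAt H (ι q₀)).open_source.mem_nhds (mem_chart_source H (ι q₀))),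
    (trivializationAt E' (fun q : O => TangentSpace I' q) q₀).open_baseSet.mem_nhds
    (FiberBundle.mem_baseSet_trivializationAt E' _ q₀)] with q hLq hq hqs hq'
  rw [trivializationAt_snd_eq_coframe hq']
  change _ = L q (anchorCoord 𝒜 (ι q₀) (ι q) (coframe F A (ι q₀) (ι q) (s (ι q))))
  rw [anchorCoord_apply hqs, frame_coframe hq, ← hY,
    ← hLq (coframe E' (fun q : O => TangentSpace I' q) q₀ q (Y q)),
    mfderivCoord_apply hι.contMDiff hqs, frame_coframe hq']

variable [I'.Boundaryless] [I.Boundaryless] [T2Space M] [ContMDiffVectorBundle ∞ F A I]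

/-- Term by term this is `d^A ω (s 0, s 1, s 2)` at `ι q`: values of the forms agree because anchors
agree, derivatives by the chain rule, and brackets because they are related. -/
theorem fieldExtDeriv_inducedForm_of_related
    (hJ : ∀ p, ∀ a ∈ T.L2 p, T.J.toFun p a ∈ T.L2 p)
    (hι : IsIntegralSubmanifold I' T.Λ ι) {σ : ∀ q : O, TangentSpace I' q →L[ℝ] A (ι q)}
    (hσ : T.IsLift I' ι σ) {s : Fin 3 → Cₛ^∞⟮I; F, A⟯}
    (hs : ∀ i x, s i x ∈ orth (T.form.toFun x) (T.L x))
    {Y : Fin 3 → Π q : O, TangentSpace I' q}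
    (hY : ∀ i q, mfderiv I' I ι q (Y i q) = 𝒜.anchor (ι q) (s i (ι q)))
    (hYd : ∀ i q, MDiffFieldAt I' (Y i) q) (q : O) :
    (inducedForm hJ hι hσ).fieldExtDeriv q (Y 0) (Y 1) (Y 2) = 0 := by
  have hcE : CompleteSpace E := FiniteDimensional.complete ℝ E
  have hcE' : CompleteSpace E' := FiniteDimensional.complete ℝ E'
  have hσs : ∀ q X, σ q X ∈ orth (T.form.toFun (ι q)) (T.L (ι q)) := fun q X =>
    T.E2_le_orth_L (hσ q X).1
  have e : ∀ i j, (fun y => (inducedForm hJ hι hσ).toFun y (Y i y) (Y j y)) =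
      (fun x => T.form.toFun x (s i x) (s j x)) ∘ ι := fun i j => funext fun y =>
    T.form_congr (hσs y (Y i y)) (hs j (ι y)) ((hσ _ _).2.trans (hY _ _))
      ((hσ _ _).2.trans (hY _ _))
  have hd : ∀ i j, MDifferentiableAt I 𝓘(ℝ, ℝ) (fun x => T.form.toFun x (s i x) (s j x)) (ι q) := by
    intro i j
    have h := MDifferentiableAt.clm_bundle_apply₂ (F₁ := F) (F₂ := F) (F₃ := ℝ)
      (E₃ := fun _ : M => ℝ) ((T.form.contMDiff (ι q)).mdifferentiableAt (by simp))
      (s i).mdifferentiableAt (s j).mdifferentiableAt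
    exact (mdifferentiableAt_section _ _).1 h
  have e₁ : ∀ i j k, mvfderiv I' (fun y => (inducedForm hJ hι hσ).toFun y (Y i y) (Y j y)) q
      (Y k q) = mvfderiv I (fun x => T.form.toFun x (s i x) (s j x)) (ι q)
        (𝒜.anchor (ι q) (s k (ι q))) := by
    intro i j k
    rw [e, ← hY]
    exact mfderiv_comp_apply q (hd i j) (hι.contMDiff.mdifferentiable (by simp) q) (Y k q)
  -- `form_congr` asks only that `σ [Y i, Y j]` and `s k` lie in `L^ω`, so nothing has to be known
  -- about the bracket `[s i, s j]` beyond its anchor.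
  have e₂ : ∀ i j k, (inducedForm hJ hι hσ).toFun q (mlieBracket I' (Y i) (Y j) q) (Y k q) =
      T.form.toFun (ι q) (𝒜.bracket (s i) (s j) (ι q)) (s k (ι q)) := fun i j k =>
    T.form_congr (hσs q _) (hs k (ι q))
      ((hσ _ _).2.trans ((mfderiv_mlieBracket_of_related hι.contMDiff (hYd i q) (hYd j q)
        (mdifferentiableAt_anchor (𝒜 := 𝒜) (s i) (ι q))
        (mdifferentiableAt_anchor (𝒜 := 𝒜) (s j) (ι q)) (hY i) (hY j)).trans
        (𝒜.anchor_bracket _ _ _).symm))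
      ((hσ _ _).2.trans (hY _ _))
  have h := T.isSymplectic.closed (s 0) (s 1) (s 2) (ι q)
  simp only [TwoForm.fieldExtDeriv, e₁, e₂]
  exact h

/-- A constant-coefficient combination of the spanning sections realises `X` at `q`. By
tensoriality, closedness need only be tested on fields of this kind. -/
theorem exists_field_eq (hι : IsIntegralSubmanifold I' T.Λ ι) (q : O) (X : TangentSpace I' q) :
    ∃ (s : Cₛ^∞⟮I; F, A⟯) (Y : Π q : O, TangentSpace I' q),
      (∀ x, s x ∈ orth (T.form.toFun x) (T.L x)) ∧
      (∀ q, mfderiv I' I ι q (Y q) = 𝒜.anchor (ι q) (s (ι q))) ∧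
      (∀ q, MDiffFieldAt I' Y q) ∧ Y q = X := by
  obtain ⟨n, s, hs, hspan⟩ := T.exists_sections_span_orth_L (ι q)
  have h : mfderiv I' I ι q X ∈ T.Λ (ι q) := by
    rw [← hι.range_mfderiv q]
    exact ⟨X, rfl⟩
  obtain ⟨a, ha, haX⟩ := T.mem_Λ.1 h
  obtain ⟨c, hc⟩ := hspan.self_of_nhds a ha
  have hsum : ∀ x, (∑ i, c i • s i : Cₛ^∞⟮I; F, A⟯) x = ∑ i, c i • s i x := fun x => by
    have h := congrFun (map_sum (ContMDiffSection.coeAddHom I F ∞ A) (fun i => c i • s i)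
      Finset.univ) x
    rw [Finset.sum_apply] at h
    exact h
  have hs' : ∀ x, (∑ i, c i • s i : Cₛ^∞⟮I; F, A⟯) x ∈ orth (T.form.toFun x) (T.L x) := fun x => by
    rw [hsum]
    exact Submodule.sum_mem _ fun i _ => Submodule.smul_mem _ _ (hs i x)
  obtain ⟨Y, hY, hYd⟩ := exists_related_field hι hs'
  refine ⟨_, Y, hs', hY, hYd, hι.injective_mfderiv q ?_⟩
  rw [hY, hsum, ← hc, haX]

theorem closed_inducedForm (hJ : ∀ p, ∀ a ∈ T.L2 p, T.J.toFun p a ∈ T.L2 p)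
    (hι : IsIntegralSubmanifold I' T.Λ ι) {σ : ∀ q : O, TangentSpace I' q →L[ℝ] A (ι q)}
    (hσ : T.IsLift I' ι σ) (V₀ V₁ V₂ : Cₛ^∞⟮I'; E', fun q : O => TangentSpace I' q⟯) (q : O) :
    (tangentLieAlgebroid I' O).extDeriv (inducedForm hJ hι hσ) V₀ V₁ V₂ q = 0 := by
  have hcE' : CompleteSpace E' := FiniteDimensional.complete ℝ E'
  choose s Y hs hY hYd hYq using fun i : Fin 3 => exists_field_eq hι q (![V₀ q, V₁ q, V₂ q] i)
  have h := fieldExtDeriv_inducedForm_of_related hJ hι hσ hs hY hYd q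
  rw [← TwoForm.fieldExtDeriv_congr _ V₀.mdifferentiableAt V₁.mdifferentiableAt
    V₂.mdifferentiableAt (hYd 0 q) (hYd 1 q) (hYd 2 q) (hYq 0).symm (hYq 1).symm (hYq 2).symm] at h
  exact h

/-- Independence of the lifts has two sources: a lift in `E²` is unique and equals `σ X`, which
settles `J_O` and `g_O`; for `ω_O` lifts in `E² + L¹` are not unique, but there `ω` depends only on
anchors. -/
theorem exists_isInducedTriple (hJ : ∀ p, ∀ a ∈ T.L2 p, T.J.toFun p a ∈ T.L2 p)
    (hι : IsIntegralSubmanifold I' T.Λ ι) :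
    ∃ S : CompatibleTriple (tangentLieAlgebroid I' O), IsInducedTriple I' T ι S := by
  obtain ⟨σ, hσ⟩ := exists_isLift T hJ hι
  obtain ⟨j, hj⟩ := exists_inducedJ hJ hι hσ
  have hform : ∀ q X Y, (inducedForm hJ hι hσ).toFun q X Y =
      T.form.toFun (ι q) (σ q X) (σ q Y) := fun _ _ _ => rfl
  have hg : ∀ q X Y, (inducedMetric hJ hι hσ).inner q X Y =
      T.g.inner (ι q) (σ q X) (σ q Y) := fun _ _ _ => rfl
  have hrel : ∀ q X Y, (inducedForm hJ hι hσ).toFun q X Y =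
      (inducedMetric hJ hι hσ).inner q X (j.toFun q Y) := by
    intro q X Y
    rw [hform, hg, hj, T.form_eq]
  have hlift : ∀ q X a, a ∈ T.E2 (ι q) → 𝒜.anchor (ι q) a = mfderiv I' I ι q X → a = σ q X :=
    fun q X a ha h => eq_of_anchor_eq (hJ _) ha (hσ q X).1 (by rw [h, (hσ q X).2])
  refine ⟨⟨inducedForm hJ hι hσ, j, inducedMetric hJ hι hσ,
    ⟨closed_inducedForm hJ hι hσ, fun q X h => ?_⟩, fun q X Y => ?_, hrel⟩, ?_, ?_, ?_⟩
  · by_contra hX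
    -- Nondegeneracy follows from positivity, since `ω_O(X, -J_O X) = g_O(X, X)`.
    have h' := h (-j.toFun q X)
    rw [hrel, map_neg, j.sq_eq_neg, neg_neg] at h'
    exact ((inducedMetric hJ hι hσ).pos q X hX).ne' h'
  · rw [hg, hg, hj, hj, T.g_J_J]
  · intro q X Y a b ha hb hX hY
    rw [T.E2_sup_L1] at ha hb
    exact T.form_congr (T.E2_le_orth_L (hσ q X).1) hb ((hσ _ _).2.trans hX.symm)
      ((hσ _ _).2.trans hY.symm)
  · intro q X a ha hX
    rw [hlift q X a ha hX, ← hj, (hσ _ _).2]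
  · intro q X Y a b ha hb hX hY
    rw [hlift q X a ha hX, hlift q Y b hb hY]
    rfl

end Closed

end CompatibleTriple

end CompatTriples

theorem mainTheorem7
    {E : Type*} [NormedAddCommGroup E] [NormedSpace ℝ E] [FiniteDimensional ℝ E]
    {H : Type*} [TopologicalSpace H] (I : ModelWithCorners ℝ E H) [I.Boundaryless]
    {M : Type*} [TopologicalSpace M] [T2Space M] [ChartedSpace H M] [IsManifold I ∞ M]
    {F : Type*} [NormedAddCommGroup F] [NormedSpace ℝ F] [FiniteDimensional ℝ F]
    {A : M → Type*} [TopologicalSpace (TotalSpace F A)]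
    [∀ p, TopologicalSpace (A p)] [∀ p, AddCommGroup (A p)] [∀ p, Module ℝ (A p)]
    [∀ p, IsTopologicalAddGroup (A p)] [∀ p, ContinuousSMul ℝ (A p)]
    [FiberBundle F A] [VectorBundle ℝ F A] [ContMDiffVectorBundle ∞ F A I]
    (𝒜 : CompatTriples.LieAlgebroid I F A) (T : CompatTriples.CompatibleTriple 𝒜)
    (hJ : ∀ p, ∀ a ∈ T.L2 p, T.J.toFun p a ∈ T.L2 p) :
    (∀ p, ∀ a ∈ T.E2 p, T.J.toFun p a ∈ T.E2 p) ∧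
    ∀ {E' : Type*} [NormedAddCommGroup E'] [NormedSpace ℝ E'] [FiniteDimensional ℝ E']
      {H' : Type*} [TopologicalSpace H'] (I' : ModelWithCorners ℝ E' H') [I'.Boundaryless]
      {O : Type*} [TopologicalSpace O] [ChartedSpace H' O] [IsManifold I' ∞ O]
      (ι : O → M), CompatTriples.IsIntegralSubmanifold I' T.Λ ι →
      ∃! S : CompatTriples.CompatibleTriple (CompatTriples.tangentLieAlgebroid I' O),
        CompatTriples.IsInducedTriple I' T ι S := by
  refine ⟨fun p _ ha => CompatTriples.CompatibleTriple.J_mem_E2 (hJ p) ha, ?_⟩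
  intro E' _ _ _ H' _ I' _ O _ _ _ ι hι
  obtain ⟨S, hS⟩ := CompatTriples.CompatibleTriple.exists_isInducedTriple hJ hι
  exact ⟨S, hS, fun _ h => CompatTriples.CompatibleTriple.eq_of_isInducedTriple hι h hS⟩
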